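/- Let $p=(p_x)_{x\ge 0}$ be a decreasing probability mass function on $\{0,1,2,\dots\}$ with bounded support, and let $\kappa=\sup\{x : p_x>0\}<\infty$. Let $X_1,X_2,\dots$ be i.i.d. with mass function $p$. Notation. For a vector $w=(w_0,\dots,w_k)$ let $\mathrm{rear}(w)$ be the vector of its entries rearranged in decreasing order, and let $\mathrm{gren}(w)$ be the vector of the $k+1$ slopes over $[x-1,x]$, $x=0,\dots,k$, of the least concave majorant on $[-1,k]$ of the points $\bigl(j,\sum_{i=0}^{j}w_i\bigr)$, $j=-1,0,\dots,k$ (the empty sum being $0$). Let $\hat p_{n,x}=n^{-1}\#\{i\le n: X_i=x\}$ be the empirical estimator. Apply $\mathrm{rear}$ and $\mathrm{gren}$ to $(\hat p_{n,0},\dots,\hat p_{n,M_n})$, where $M_n=\max_{i\le n}X_i$, and extend by $0$ beyond $M_n$: this gives the rearrangement estimator $\hat p_n^R$ and the maximum likelihood (Grenander) estimator $\hat p_n^G$. Write $H^2(p,q)=\frac12\sum_{x\ge0}(\sqrt{p_x}-\sqrt{q_x})^2$. Let $Y$ be a centred Gaussian process with $\mathrm{Cov}(Y_x,Y_z)=p_x\delta_{x,z}-p_xp_z$,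 and let $Y^G$ be obtained from $Y$ by replacing, for every maximal interval $\{r,\dots,s\}\subseteq\{0,\dots,\kappa\}$ on which $p$ is constant, $(Y_r,\dots,Y_s)$ by $\mathrm{gren}(Y_r,\dots,Y_s)$. Put $$W=\sum_{x=0}^{\kappa}\frac{Y_x^2}{p_x},\qquad W^G=\sum_{x=0}^{\kappa}\frac{(Y^G_x)^2}{p_x}.$$ Call $p$ strictly monotone if $p_0>p_1>\dots>p_\kappa$. Then, as $n\to\infty$: 1. $nH^2(\hat p_n,p)\to_d\frac18W$, $\;nH^2(\hat p_n^R,p)\to_d\frac18W$ and $\;nH^2(\hat p_n^G,p)\to_d\frac18W^G$. 2. $P(\frac18W^G>t)\le P(\frac18W>t)$ for all $t\in\mathbb R$; and if $p$ is not strictly monotone, then $P(\frac18W^G>t)<P(\frac18W>t)$ for all $t>0$. 3. $W$ has the chi-squared distribution with $\kappa$ degrees of freedom (the unit mass at $0$ if $\kappa=0$). 4. The convergences in 1 also hold in expectation, all the expectations being finite: $E[nH^2(\hat p_n,p)]\to\frac18E[W]$, $\;E[nH^2(\hat p_n^R,p)]\to\frac18E[W]$, $\;E[nH^2(\hat p_n^G,p)]\to\frac18E[W^G]$.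 5. $E[W^G]\le E[W]=\kappa$, and $E[W^G]=E[W]$ if and only if $p$ is strictly monotone. -/

import Mathlib

open MeasureTheory ProbabilityTheory Filter Topology

namespace MonotonePMF

noncomputable section

/-- The squared Hellinger distance `H²(p, q) = (1/2) ∑_{x ≥ 0} (√p_x - √q_x)²`. -/
def hellingerSq (p q : ℕ → ℝ) : ℝ :=
  (1 / 2) * ∑' x, (√(p x) - √(q x)) ^ 2

/-- The reverse-ordered vector: the entries of `(w_0, …, w_k)` rearranged in decreasing order,
extended by zero beyond the index `k`. -/
def rear (k : ℕ) (w : ℕ → ℝ) (x : ℕ) : ℝ :=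
  if h : x < k + 1 then
    w (Tuple.sort (fun i : Fin (k + 1) => OrderDual.toDual (w i)) ⟨x, h⟩)
  else 0

/-- The least concave majorant on `[-1, k]` of the points `(j, ∑_{i ≤ j} w_i)`,
`j = -1, 0, …, k` (here `j` is written as `m - 1` with `m = 0, …, k + 1`). -/
def leastConcaveMajorant (k : ℕ) (w : ℕ → ℝ) (t : ℝ) : ℝ :=
  sInf {y | ∃ g : ℝ → ℝ, ConcaveOn ℝ (Set.Icc (-1) (k : ℝ)) g ∧
    (∀ m ∈ Finset.range (k + 2), ∑ i ∈ Finset.range m, w i ≤ g ((m : ℝ) - 1)) ∧ y = g t}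

/-- The operator `gren`: the vector of the `k + 1` slopes, over the intervals `[x - 1, x]` for
`x = 0, …, k`, of the least concave majorant of the cumulative sums of `(w_0, …, w_k)`,
extended by zero beyond the index `k`. -/
def gren (k : ℕ) (w : ℕ → ℝ) (x : ℕ) : ℝ :=
  if x ≤ k then leastConcaveMajorant k w x - leastConcaveMajorant k w ((x : ℝ) - 1) else 0

variable {Ω : Type*}

/-- The empirical estimator based on the first `n` observations `X 0, …, X (n - 1)`. -/
def empirical (X : ℕ → Ω → ℕ) (n : ℕ) (ω : Ω) (x : ℕ) : ℝ :=
  (n : ℝ)⁻¹ * ∑ i ∈ Finset.range n, if X i ω = x then 1 else 0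

/-- The largest of the first `n` observations. -/
def sampleMax (X : ℕ → Ω → ℕ) (n : ℕ) (ω : Ω) : ℕ :=
  (Finset.range n).sup fun i => X i ω

/-- The rearrangement estimator. -/
def rearrangement (X : ℕ → Ω → ℕ) (n : ℕ) (ω : Ω) : ℕ → ℝ :=
  rear (sampleMax X n ω) (empirical X n ω)

/-- The maximum likelihood (Grenander) estimator. -/
def grenander (X : ℕ → Ω → ℕ) (n : ℕ) (ω : Ω) : ℕ → ℝ :=
  gren (sampleMax X n ω) (empirical X n ω)

/-- First index of the period of constancy of `p` that contains `x`. -/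
def blockStart (p : ℕ → ℝ) (x : ℕ) : ℕ := sInf {r | p r = p x}

/-- Last index of the period of constancy of `p` that contains `x` (used where `p x > 0`). -/
def blockEnd (p : ℕ → ℝ) (x : ℕ) : ℕ := sSup {s | p s = p x}

/-- The operator `y ↦ y^G` attached to a decreasing `p`: on every period of constancy
`{r, …, s}` of `p` one has `(y^G)^{(r,s)} = gren (y^{(r,s)})`. (A period with `r = s` leaves the
entry unchanged, because `gren` of a vector of length one is that vector.) -/
def blockGren (p : ℕ → ℝ) (y : ℕ → ℝ) (x : ℕ) : ℝ :=
  gren (blockEnd p x - blockStart p x) (fun j => y (blockStart p x + j)) (x - blockStart p x)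

/-- The chi-squared law with `k` degrees of freedom: the law of the sum of the squares of `k`
independent standard normal variables (the unit mass at `0` if `k = 0`). -/
def chiSquared (k : ℕ) : Measure ℝ :=
  (Measure.pi fun _ : Fin k => gaussianReal 0 1).map fun z => ∑ i, z i ^ 2

/-- `Y` is a Gaussian process with mean zero and `cov(Y_x, Y_y) = p_x δ_{x,y} - p_x p_y`. -/
structure IsLimitProcess [MeasurableSpace Ω] (p : ℕ → ℝ) (Y : ℕ → Ω → ℝ) (P : Measure Ω) :
    Prop where
  gaussian : IsGaussianProcess Y P
  mean : ∀ x, ∫ ω, Y x ω ∂P = 0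
  covariance : ∀ x y, cov[Y x, Y y; P] = (if x = y then p x else 0) - p x * p y

end

end MonotonePMF

open MonotonePMF

/-! With `z = √n (p̂ - p)`, expanding the square root turns `n H²(p̂, p)` into `(1/8) ∑ z_x² / p_x`
with an error cubic in `z`. Everything then reduces to the central limit theorem in dimension `κ +
1`, provided that the two order-restricted estimators can be expressed through `z`.

The bridge is that `gren` is the Euclidean projection onto decreasing vectors (`isProj_gren`) and
`blockGren` the projection onto vectors decreasing on each block of constancy of `p`
(`isProj_blockGren`). If `p̂` is closer to `p` than half the least gap between values of `p`, the
order between blocks cannot be violated: rearranging only permutes entries inside blocks, which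
leaves the distance unchanged (`sum_rear_eq`), and `gren` acts on the deviation as `blockGren`
(`gren_eq_add_blockGren`). If `p̂` is far from `p`, a crude bound on `n H²` is absorbed by `‖z‖⁴`.
So one pathwise inequality with error of order `(1 + ‖z‖⁴) / √n` covers all cases
(`exists_abs_hellingerSq_sub_le`). Bounded fourth moments make this error vanish in mean and yield
both modes of convergence (`tendsto_of_abs_sub_le`).

As for the limits, the projection also contracts the norm with weights `1 / p`, so `W^G ≤ W`
pointwise. On `{0, …, κ}`, `Y / √p` is a standard normal vector in the orthogonal complement of `√p`
(`IsLimitProcess.exists_standardization`), whence the chi-squared law. If `p_x = p_y` with `x < y ≤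
κ`, a vector that is negative at `x`, opposite at `y` and zero elsewhere is projected to zero
although its quadratic form is positive; by continuity and full support of the normal law, `W^G < t
< W` has positive probability for each `t > 0` (`IsLimitProcess.measure_lt_pos`). -/

namespace MonotonePMF

/-! ### Projections onto cones of blockwise decreasing vectors. -/

/-- `u` is decreasing on every part of `{0, …, k}` on which `p` is constant. -/
def BlockAnti (k : ℕ) (p u : ℕ → ℝ) : Prop :=
  ∀ x y, x ≤ y → y ≤ k → p x = p y → u y ≤ u x

/-- `v` is the projection of `w` onto the cone of vectors on `{0, …, k}` that are decreasing on
every part on which `p` is constant. -/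
structure IsProj (k : ℕ) (p w v : ℕ → ℝ) : Prop where
  anti : BlockAnti k p v
  le : ∀ u, BlockAnti k p u → ∑ x ∈ Finset.range (k + 1), (w x - v x) * u x ≤ 0
  eq : ∑ x ∈ Finset.range (k + 1), (w x - v x) * v x = 0

/-- Expanding `‖w - w'‖²` around `v - v'` leaves a square and a cross term; the latter is
nonnegative because each residual is orthogonal to its own projection and has nonpositive product
with the other one. -/
theorem IsProj.contraction {k : ℕ} {p w v w' v' : ℕ → ℝ} (h : IsProj k p w v)
    (h' : IsProj k p w' v') :
    ∑ x ∈ Finset.range (k + 1), (v x - v' x) ^ 2 ≤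
      ∑ x ∈ Finset.range (k + 1), (w x - w' x) ^ 2 := by
  have h1 := h.le v' h'.anti
  have h2 := h'.le v h.anti
  have h3 := h.eq
  have h4 := h'.eq
  have h5 : 0 ≤ ∑ x ∈ Finset.range (k + 1), ((w x - w' x) - (v x - v' x)) ^ 2 :=
    Finset.sum_nonneg fun _ _ => sq_nonneg _
  have h6 : ∑ x ∈ Finset.range (k + 1), (w x - w' x) ^ 2 =
      ∑ x ∈ Finset.range (k + 1), (v x - v' x) ^ 2 +
      ∑ x ∈ Finset.range (k + 1), ((w x - w' x) - (v x - v' x)) ^ 2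
      + 2 * ((∑ x ∈ Finset.range (k + 1), (w x - v x) * v x)
        - (∑ x ∈ Finset.range (k + 1), (w x - v x) * v' x)
        - (∑ x ∈ Finset.range (k + 1), (w' x - v' x) * v x)
        + (∑ x ∈ Finset.range (k + 1), (w' x - v' x) * v' x)) := by
    simp only [← Finset.sum_add_distrib, ← Finset.sum_sub_distrib, Finset.mul_sum]
    exact Finset.sum_congr rfl fun _ _ => by ring
  linarith

theorem IsProj.unique {k : ℕ} {p w v v' : ℕ → ℝ} (h : IsProj k p w v)
    (h' : IsProj k p w v') {x : ℕ} (hx : x ≤ k) : v x = v' x := by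
  have h1 := h.contraction h'
  simp only [sub_self, ne_eq, OfNat.ofNat_ne_zero, not_false_eq_true, zero_pow,
    Finset.sum_const_zero] at h1
  have h2 := Finset.single_le_sum (f := fun x => (v x - v' x) ^ 2)
    (fun _ _ => sq_nonneg _) (Finset.mem_range.2 (Nat.lt_succ_of_le hx))
  have h3 : (v x - v' x) ^ 2 = 0 := le_antisymm (h2.trans h1) (sq_nonneg _)
  exact sub_eq_zero.1 (pow_eq_zero_iff (two_ne_zero) |>.1 h3)

theorem isProj_zero (k : ℕ) (p : ℕ → ℝ) : IsProj k p 0 0 :=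
  ⟨fun _ _ _ _ _ => le_rfl, fun _ _ => by simp, by simp⟩

theorem IsProj.norm_le {k : ℕ} {p w v : ℕ → ℝ} (h : IsProj k p w v) :
    ∑ x ∈ Finset.range (k + 1), v x ^ 2 ≤ ∑ x ∈ Finset.range (k + 1), w x ^ 2 := by
  simpa using h.contraction (isProj_zero k p)

/-- The projection is also a contraction for the weights `1 / p`. -/
theorem IsProj.weighted_norm_le {k : ℕ} {p w v : ℕ → ℝ} (h : IsProj k p w v)
    (hp : Antitone p) (hpk : 0 < p k) :
    ∑ x ∈ Finset.range (k + 1), v x ^ 2 / p x ≤ ∑ x ∈ Finset.range (k + 1), w x ^ 2 / p x := by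
  -- A nonnegative multiplier that is constant on blocks preserves the cone. The shift by `(p k)⁻¹`
  -- secures the sign and costs nothing, since `w - v` is orthogonal to `v`.
  have h1 := h.le (fun x => ((p k)⁻¹ - (p x)⁻¹) * v x) (by
    intro x y hxy hy hpe
    simp only [hpe]
    refine mul_le_mul_of_nonneg_left (h.anti x y hxy hy hpe) ?_
    exact sub_nonneg.2 (inv_anti₀ hpk (hp hy)))
  have h2 := h.eq
  have h3 : 0 ≤ ∑ x ∈ Finset.range (k + 1), (w x - v x) * v x / p x := by
    have : ∑ x ∈ Finset.range (k + 1), (w x - v x) * (((p k)⁻¹ - (p x)⁻¹) * v x) =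
        (p k)⁻¹ * (∑ x ∈ Finset.range (k + 1), (w x - v x) * v x) -
        ∑ x ∈ Finset.range (k + 1), (w x - v x) * v x / p x := by
      simp only [← Finset.sum_sub_distrib, Finset.mul_sum]
      exact Finset.sum_congr rfl fun _ _ => by ring
    rw [this, h2] at h1
    linarith
  have h4 : ∑ x ∈ Finset.range (k + 1), w x ^ 2 / p x =
      ∑ x ∈ Finset.range (k + 1), v x ^ 2 / p x +
      ∑ x ∈ Finset.range (k + 1), (w x - v x) ^ 2 / p x +
      2 * ∑ x ∈ Finset.range (k + 1), (w x - v x) * v x / p x := by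
    simp only [← Finset.sum_add_distrib, Finset.mul_sum]
    exact Finset.sum_congr rfl fun _ _ => by ring
  have h5 : 0 ≤ ∑ x ∈ Finset.range (k + 1), (w x - v x) ^ 2 / p x :=
    Finset.sum_nonneg fun x hx => div_nonneg (sq_nonneg _)
      (hpk.le.trans (hp (Nat.le_of_lt_succ (Finset.mem_range.1 hx))))
  linarith

/-- Existence of the projection onto the decreasing vectors. -/
theorem exists_isProj (k : ℕ) (w : ℕ → ℝ) : ∃ v, IsProj k 0 w v := by
  -- With `p = 0` all indices form one block, so the cone is that of the decreasing vectors.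
  let K : Set (EuclideanSpace ℝ (Fin (k + 1))) := {u | ∀ i j : Fin (k + 1), i ≤ j → u j ≤ u i}
  have hcl : IsClosed K := by
    simp only [K, Set.ofPred_forall]
    refine isClosed_iInter fun i => isClosed_iInter fun j => isClosed_iInter fun _ => ?_
    exact isClosed_le (by fun_prop) (by fun_prop)
  have hsmul : ∀ c : ℝ, 0 ≤ c → ∀ u ∈ K, c • u ∈ K := fun c hc u hu i j hij => by
    simpa using mul_le_mul_of_nonneg_left (hu i j hij) hc
  have hadd : ∀ u ∈ K, ∀ v ∈ K, u + v ∈ K := fun u hu v hv i j hij => by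
    simpa using add_le_add (hu i j hij) (hv i j hij)
  have hz : (0 : EuclideanSpace ℝ (Fin (k + 1))) ∈ K := fun _ _ _ => le_rfl
  have hcv : Convex ℝ K := fun u hu v hv a b ha hb _ =>
    hadd _ (hsmul a ha u hu) _ (hsmul b hb v hv)
  let w' : EuclideanSpace ℝ (Fin (k + 1)) := WithLp.toLp 2 fun i => w i
  obtain ⟨v, hvK, hv⟩ := exists_norm_eq_iInf_of_complete_convex ⟨0, hz⟩ hcl.isComplete hcv w'
  -- Because `K` is a convex cone, the variational inequality splits: the competitor `u + v` gives
  -- `hle`, and the competitor `0` gives the missing half of `heq`.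
  rw [norm_eq_iInf_iff_real_inner_le_zero hcv hvK] at hv
  have h0 := hv 0 hz
  have hle : ∀ u ∈ K, inner ℝ (w' - v) u ≤ 0 := fun u hu => by
    simpa using hv _ (hadd v hvK u hu)
  have heq : inner ℝ (w' - v) v = 0 := by
    refine le_antisymm (hle v hvK) ?_
    simpa [inner_neg_right] using h0
  let v' : ℕ → ℝ := fun x => if h : x < k + 1 then v ⟨x, h⟩ else 0
  have hv' : ∀ i : Fin (k + 1), v' i = v i := fun i => by simp only [v', i.2, dif_pos]
  have hin : ∀ u : EuclideanSpace ℝ (Fin (k + 1)), ∀ u' : ℕ → ℝ, (∀ i : Fin (k + 1), u' i = u i) →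
      ∑ x ∈ Finset.range (k + 1), (w x - v' x) * u' x = inner ℝ (w' - v) u := fun u u' hu => by
    rw [Finset.sum_range, PiLp.inner_apply]
    refine Finset.sum_congr rfl fun i _ => ?_
    simp [hu, hv', w', mul_comm]
  refine ⟨v', fun x y hxy hy _ => ?_, fun u hu => ?_, ?_⟩
  · have := hvK ⟨x, by omega⟩ ⟨y, by omega⟩ hxy
    simpa only [v', Nat.lt_succ_of_le hy, Nat.lt_succ_of_le (hxy.trans hy), dif_pos] using this
  · rw [hin (WithLp.toLp 2 fun i => u i) u fun _ => rfl]
    exact hle _ fun i j hij => hu i j hij (Nat.le_of_lt_succ j.2) rfl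
  · rw [hin v v' hv', heq]

/-! ### Slopes of the least concave majorant as a projection. -/

section LeastConcaveMajorant

variable {k : ℕ} {w v : ℕ → ℝ}

theorem IsProj.antitone (h : IsProj k 0 w v) {x y : ℕ} (hxy : x ≤ y) (hy : y ≤ k) : v y ≤ v x :=
  h.anti x y hxy hy rfl

theorem sum_ite_lt {m : ℕ} (hm : m ≤ k + 1) (f : ℕ → ℝ) :
    ∑ x ∈ Finset.range (k + 1), f x * (if x < m then 1 else 0) = ∑ x ∈ Finset.range m, f x := by
  simp only [mul_ite, mul_one, mul_zero]
  rw [← Finset.sum_filter]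
  refine Finset.sum_congr ?_ fun _ _ => rfl
  ext x
  simp only [Finset.mem_filter, Finset.mem_range]
  omega

/-- Indicators of initial segments are decreasing, hence admissible test vectors. -/
theorem IsProj.sum_le (h : IsProj k 0 w v) {m : ℕ} (hm : m ≤ k + 1) :
    ∑ x ∈ Finset.range m, w x ≤ ∑ x ∈ Finset.range m, v x := by
  have h1 := h.le (fun x => if x < m then 1 else 0) (fun x y hxy _ _ => by
    dsimp only
    split_ifs <;> first | omega | norm_num)
  rw [sum_ite_lt hm, Finset.sum_sub_distrib] at h1
  linarith

theorem IsProj.sum_eq (h : IsProj k 0 w v) :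
    ∑ x ∈ Finset.range (k + 1), w x = ∑ x ∈ Finset.range (k + 1), v x := by
  have h1 := h.le (fun _ => -1) (fun _ _ _ _ _ => le_rfl)
  have h2 := h.sum_le le_rfl
  simp only [mul_neg, mul_one, Finset.sum_neg_distrib, Finset.sum_sub_distrib] at h1
  linarith

/-- Complementary slackness: lowering `v` on `{0, …, m}` by the height of the jump keeps it
decreasing, so the indicator of this segment can be tested with the opposite sign too. -/
theorem IsProj.sum_eq_of_jump (h : IsProj k 0 w v) {m : ℕ} (hm : m + 1 ≤ k)
    (hj : v (m + 1) < v m) :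
    ∑ x ∈ Finset.range (m + 1), w x = ∑ x ∈ Finset.range (m + 1), v x := by
  refine le_antisymm (h.sum_le (by omega)) ?_
  have h1 := h.le (fun x => v x + (v (m + 1) - v m) * (if x < m + 1 then 1 else 0)) (by
    intro x y hxy hy _
    have h2 := h.antitone hxy hy
    dsimp only
    split_ifs with h3 h4 h4
    · linarith
    · omega
    · have h5 := h.antitone (show x ≤ m by omega) (by omega)
      have h6 := h.antitone (show m + 1 ≤ y by omega) hy
      linarith
    · linarith)
  have h2 : ∑ x ∈ Finset.range (k + 1), (w x - v x) *
      (v x + (v (m + 1) - v m) * (if x < m + 1 then 1 else 0)) =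
      ∑ x ∈ Finset.range (k + 1), (w x - v x) * v x + (v (m + 1) - v m) *
      ∑ x ∈ Finset.range (k + 1), (w x - v x) * (if x < m + 1 then 1 else 0) := by
    rw [Finset.mul_sum, ← Finset.sum_add_distrib]
    exact Finset.sum_congr rfl fun _ _ => by ring
  rw [h2, h.eq, sum_ite_lt (by omega), zero_add, Finset.sum_sub_distrib] at h1
  have h3 := nonneg_of_mul_nonpos_right h1 (sub_neg.2 hj)
  linarith

/-- Every concave majorant lies above the partial sums of the projection. -/
theorem IsProj.sum_le_of_concaveOn (h : IsProj k 0 w v) {g : ℝ → ℝ}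
    (hg : ConcaveOn ℝ (Set.Icc (-1) (k : ℝ)) g)
    (hgw : ∀ m ∈ Finset.range (k + 2), ∑ i ∈ Finset.range m, w i ≤ g ((m : ℝ) - 1))
    {m : ℕ} (hm : m ≤ k + 1) : ∑ i ∈ Finset.range m, v i ≤ g ((m : ℝ) - 1) := by
  let d : ℕ → ℝ := fun m => ∑ i ∈ Finset.range m, v i - g ((m : ℝ) - 1)
  by_contra! hlt
  -- Take the leftmost maximiser `a` of `d`, the partial sums of `v` minus `g`. If `d a > 0`, then
  -- `v` has no jump at `a`, so its partial sums are affine on `a - 1, a, a + 1` and `d` is midpoint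
  -- convex there; this contradicts `d (a - 1) < d a` and `d (a + 1) ≤ d a`.
  have hex : ∃ a, a ≤ k + 1 ∧ ∀ j ≤ k + 1, d j ≤ d a := by
    obtain ⟨a, ha, ha'⟩ := Finset.exists_max_image (Finset.range (k + 2)) d ⟨0, by simp⟩
    exact ⟨a, by simpa [Nat.lt_succ_iff] using ha, fun j hj => ha' j (by simp; omega)⟩
  classical
  obtain ⟨ha, hmax⟩ := Nat.find_spec hex
  have hmin := fun b => Nat.find_min hex (m := b)
  set a := Nat.find hex
  have hda : 0 < d a := lt_of_lt_of_le (sub_pos.2 hlt) (hmax m hm)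
  have hw := hgw a (by simp; omega)
  have hVW : ∑ i ∈ Finset.range a, w i < ∑ i ∈ Finset.range a, v i := by
    simp only [d] at hda; linarith
  have ha0 : a ≠ 0 := fun h0 => by simp [h0] at hVW
  have hak : a ≠ k + 1 := fun h0 => by rw [h0, h.sum_eq] at hVW; exact lt_irrefl _ hVW
  obtain ⟨b, hb⟩ := Nat.exists_eq_succ_of_ne_zero ha0
  have hv : v (b + 1) = v b := by
    by_contra hne
    have := h.sum_eq_of_jump (m := b) (by omega)
      (lt_of_le_of_ne (h.antitone (Nat.le_succ b) (by omega)) hne)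
    rw [hb] at hVW
    exact absurd this hVW.ne
  have hdb : d b < d a := by
    by_contra! hle
    exact hmin b (by omega) ⟨by omega, fun j hj => (hmax j hj).trans hle⟩
  have hdc := hmax (a + 1) (by omega)
  have hbk : (b : ℝ) + 1 ≤ k := by exact_mod_cast (show b + 1 ≤ k by omega)
  have hb0 : (0 : ℝ) ≤ b := b.cast_nonneg
  have hb1 : (b : ℝ) - 1 ∈ Set.Icc (-1) (k : ℝ) := ⟨by linarith, by linarith⟩
  have hb2 : (b : ℝ) + 1 ∈ Set.Icc (-1) (k : ℝ) := ⟨by linarith, by linarith⟩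
  have hcc := hg.2 hb1 hb2 (show (0 : ℝ) ≤ 1 / 2 by norm_num) (show (0 : ℝ) ≤ 1 / 2 by norm_num)
    (by norm_num)
  simp only [smul_eq_mul] at hcc
  rw [show (1 / 2 : ℝ) * (b - 1) + 1 / 2 * (b + 1) = b by ring] at hcc
  simp only [d, hb, Nat.succ_eq_add_one, Finset.sum_range_succ, hv] at hdb hdc
  push_cast at hdb hdc
  rw [show (b : ℝ) + 1 - 1 = b by ring] at hdb hdc
  rw [show (b : ℝ) + 1 + 1 - 1 = b + 1 by ring] at hdc
  linarith

/-- Partial sums of a decreasing sequence lie below each of their supporting lines. -/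
theorem IsProj.tangent (h : IsProj k 0 w v) {m x : ℕ} (hm : m ≤ k + 1) (hx : x ≤ k) :
    ∑ i ∈ Finset.range m, v i ≤ ∑ i ∈ Finset.range x, v i + v x * ((m : ℝ) - x) := by
  rcases le_total x m with hxm | hxm
  · have h1 : ∑ i ∈ Finset.Ico x m, v i ≤ ∑ i ∈ Finset.Ico x m, v x :=
      Finset.sum_le_sum fun i hi => by
        rw [Finset.mem_Ico] at hi
        exact h.antitone hi.1 (by omega)
    rw [Finset.sum_Ico_eq_sub v hxm, Finset.sum_const, Nat.card_Ico, nsmul_eq_mul,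
      Nat.cast_sub hxm] at h1
    linarith
  · have h1 : ∑ i ∈ Finset.Ico m x, v x ≤ ∑ i ∈ Finset.Ico m x, v i :=
      Finset.sum_le_sum fun i hi => by
        rw [Finset.mem_Ico] at hi
        exact h.antitone hi.2.le hx
    rw [Finset.sum_Ico_eq_sub v hxm, Finset.sum_const, Nat.card_Ico, nsmul_eq_mul,
      Nat.cast_sub hxm] at h1
    linarith

/-- The minimum of the `k + 1` supporting lines is concave and interpolates the partial sums of `v`,
so the lower bound for concave majorants is attained. -/
theorem IsProj.exists_concaveOn (h : IsProj k 0 w v) :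
    ∃ g : ℝ → ℝ, ConcaveOn ℝ (Set.Icc (-1) (k : ℝ)) g ∧
      ∀ m ≤ k + 1, g ((m : ℝ) - 1) = ∑ i ∈ Finset.range m, v i := by
  let L : ℕ → ℝ → ℝ := fun x t => ∑ i ∈ Finset.range x, v i + v x * (t + 1 - x)
  have hne : (Finset.range (k + 1)).Nonempty := ⟨0, by simp⟩
  have hL : ∀ x, ConcaveOn ℝ (Set.Icc (-1) (k : ℝ)) (L x) := fun x =>
    ⟨convex_Icc _ _, fun s _ t _ a b _ _ hab => by
      simp only [L, smul_eq_mul]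
      have hb : b = 1 - a := by linarith
      subst hb
      apply le_of_eq; ring⟩
  refine ⟨(Finset.range (k + 1)).inf' hne L,
    Finset.inf'_induction hne L (fun _ h1 _ h2 => h1.inf h2) fun x _ => hL x, fun m hm => ?_⟩
  rw [Finset.inf'_apply]
  have hLm : ∀ x, L x ((m : ℝ) - 1) = ∑ i ∈ Finset.range x, v i + v x * ((m : ℝ) - x) :=
    fun x => by simp only [L]; ring
  apply le_antisymm
  · rcases Nat.lt_or_ge m (k + 1) with hmk | hmk
    · refine (Finset.inf'_le _ (Finset.mem_range.2 hmk)).trans_eq ?_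
      rw [hLm]; ring
    -- The last node has no line of its own; the line of index `k` passes through it.
    · obtain rfl : m = k + 1 := le_antisymm hm hmk
      refine (Finset.inf'_le _ (Finset.mem_range.2 (Nat.lt_succ_self k))).trans_eq ?_
      rw [hLm, Finset.sum_range_succ]; push_cast; ring
  · refine Finset.le_inf' _ _ fun x hx => ?_
    rw [hLm]
    exact h.tangent hm (Nat.le_of_lt_succ (Finset.mem_range.1 hx))

theorem IsProj.leastConcaveMajorant_eq (h : IsProj k 0 w v) {m : ℕ} (hm : m ≤ k + 1) :
    leastConcaveMajorant k w ((m : ℝ) - 1) = ∑ i ∈ Finset.range m, v i := by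
  refine IsLeast.csInf_eq ⟨?_, ?_⟩
  · obtain ⟨g, hg, hgv⟩ := h.exists_concaveOn
    refine ⟨g, hg, fun j hj => ?_, (hgv m hm).symm⟩
    have hj' : j ≤ k + 1 := Nat.le_of_lt_succ (Finset.mem_range.1 hj)
    exact (h.sum_le hj').trans_eq (hgv j hj').symm
  · rintro y ⟨g, hg, hgw, rfl⟩
    exact h.sum_le_of_concaveOn hg hgw hm

theorem IsProj.gren_eq (h : IsProj k 0 w v) {x : ℕ} (hx : x ≤ k) : gren k w x = v x := by
  rw [gren, if_pos hx, h.leastConcaveMajorant_eq (by omega)]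
  have := h.leastConcaveMajorant_eq (m := x + 1) (by omega)
  rw [Nat.cast_add, Nat.cast_one, add_sub_cancel_right] at this
  rw [this, Finset.sum_range_succ]
  ring

theorem isProj_gren (k : ℕ) (w : ℕ → ℝ) : IsProj k 0 w (gren k w) := by
  obtain ⟨v, hv⟩ := exists_isProj k w
  have hx : ∀ x ∈ Finset.range (k + 1), gren k w x = v x := fun x hx =>
    hv.gren_eq (Nat.le_of_lt_succ (Finset.mem_range.1 hx))
  refine ⟨fun x y hxy hy _ => ?_, fun u hu => ?_, ?_⟩
  · rw [hv.gren_eq hy, hv.gren_eq (hxy.trans hy)]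
    exact hv.antitone hxy hy
  · rw [Finset.sum_congr rfl fun x h => by rw [hx x h]]
    exact hv.le u hu
  · rw [Finset.sum_congr rfl fun x h => by rw [hx x h]]
    exact hv.eq

end LeastConcaveMajorant

/-! ### The blockwise operator as a projection. -/

section BlockGren

variable {p : ℕ → ℝ} {κ : ℕ}

theorem le_of_eq_pos (hp : Antitone p) (hκ : IsGreatest {x | 0 < p x} κ) {x z : ℕ} (hx : x ≤ κ)
    (h : p z = p x) : z ≤ κ :=
  hκ.2 (show 0 < p z from h ▸ lt_of_lt_of_le hκ.1 (hp hx))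

/-- The block of `x` is the interval from `blockStart` to `blockEnd`. -/
theorem mem_block_iff (hp : Antitone p) (hκ : IsGreatest {x | 0 < p x} κ) {x : ℕ} (hx : x ≤ κ)
    (z : ℕ) : p z = p x ↔ blockStart p x ≤ z ∧ z ≤ blockEnd p x := by
  -- Boundedness matters: `sSup` of an unbounded set of naturals is `0`. Positivity of `p x` keeps
  -- the block below `κ`.
  have hb : BddAbove {s | p s = p x} := ⟨κ, fun z hz => le_of_eq_pos hp hκ hx hz⟩
  have hs : p (blockStart p x) = p x := Nat.sInf_mem (s := {r | p r = p x}) ⟨x, rfl⟩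
  have he : p (blockEnd p x) = p x := Nat.sSup_mem (s := {r | p r = p x}) ⟨x, rfl⟩ hb
  constructor
  · exact fun h => ⟨Nat.sInf_le h, le_csSup hb h⟩
  · rintro ⟨h1, h2⟩
    exact le_antisymm ((hp h1).trans_eq hs) (he.symm.trans_le (hp h2))

theorem blockStart_congr {x y : ℕ} (h : p x = p y) : blockStart p x = blockStart p y := by
  simp [blockStart, h]

theorem blockEnd_congr {x y : ℕ} (h : p x = p y) : blockEnd p x = blockEnd p y := by
  simp [blockEnd, h]

/-- Both the cone and the inner product split over the blocks, and on each block `gren` is the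
projection onto decreasing vectors. -/
theorem isProj_blockGren (hp : Antitone p) (hκ : IsGreatest {x | 0 < p x} κ) (w : ℕ → ℝ) :
    IsProj κ p w (blockGren p w) := by
  -- Blocks are indexed by their first element `c`; the block of `c` is `{c, …, c + l}`.
  have key : ∀ c ∈ (Finset.range (κ + 1)).image (blockStart p), ∃ l,
      (∀ f : ℕ → ℝ, ∑ x ∈ Finset.range (κ + 1) with blockStart p x = c, f x =
        ∑ j ∈ Finset.range (l + 1), f (c + j)) ∧
      (∀ j ≤ l, blockGren p w (c + j) = gren l (fun j => w (c + j)) j) ∧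
      (∀ j ≤ l, c + j ≤ κ) ∧ ∀ i ≤ l, ∀ j ≤ l, p (c + i) = p (c + j) := by
    intro c hc
    obtain ⟨x, hx, rfl⟩ := Finset.mem_image.1 hc
    have hxκ : x ≤ κ := Nat.le_of_lt_succ (Finset.mem_range.1 hx)
    have hmem := mem_block_iff hp hκ hxκ
    have hx2 := (hmem x).1 rfl
    have hpj : ∀ j ≤ blockEnd p x - blockStart p x, p (blockStart p x + j) = p x :=
      fun j hj => (hmem _).2 ⟨by omega, by omega⟩
    refine ⟨blockEnd p x - blockStart p x, fun f => ?_, fun j hj => ?_, fun j hj => ?_,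
      fun i hi j hj => (hpj i hi).trans (hpj j hj).symm⟩
    · symm
      refine Finset.sum_bij (fun j _ => blockStart p x + j) ?_ ?_ ?_ ?_
      · intro j hj
        rw [Finset.mem_range] at hj
        have := hpj j (by omega)
        simp only [Finset.mem_filter, Finset.mem_range]
        exact ⟨Nat.lt_succ_of_le (le_of_eq_pos hp hκ hxκ this), blockStart_congr this⟩
      · intro i _ j _ h; omega
      · intro y hy
        simp only [Finset.mem_filter, Finset.mem_range] at hy
        have hyκ : y ≤ κ := by omega
        have hy2 := (mem_block_iff hp hκ hyκ _).1 rfl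
        have h3 : p (blockStart p x) = p y := (mem_block_iff hp hκ hyκ _).2
          ⟨hy.2.le, hy.2.symm.le.trans (hy2.1.trans hy2.2)⟩
        have h4 : p (blockStart p x) = p x := by simpa using hpj 0 (by omega)
        have h5 := (hmem y).1 (h3.symm.trans h4)
        exact ⟨y - blockStart p x, by rw [Finset.mem_range]; omega, by omega⟩
      · intro _ _; rfl
    · rw [blockGren, blockStart_congr (hpj j hj), blockEnd_congr (hpj j hj), Nat.add_sub_cancel_left]
    · exact le_of_eq_pos hp hκ hxκ (hpj j hj)
  have hmaps : ∀ x ∈ Finset.range (κ + 1),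
      blockStart p x ∈ (Finset.range (κ + 1)).image (blockStart p) :=
    fun x hx => Finset.mem_image_of_mem _ hx
  refine ⟨fun x y hxy hy hpe => ?_, fun u hu => ?_, ?_⟩
  · have hx2 := (mem_block_iff hp hκ (hxy.trans hy) x).1 rfl
    have hy2 := (mem_block_iff hp hκ (hxy.trans hy) y).1 hpe.symm
    rw [blockGren, blockGren, blockStart_congr hpe.symm, blockEnd_congr hpe.symm]
    exact (isProj_gren _ _).antitone (by omega) (by omega)
  · rw [← Finset.sum_fiberwise_of_maps_to hmaps]
    refine Finset.sum_nonpos fun c hc => ?_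
    obtain ⟨l, h1, h2, h3, h4⟩ := key c hc
    rw [h1, Finset.sum_congr rfl fun j hj => by
      rw [h2 j (Nat.le_of_lt_succ (Finset.mem_range.1 hj))]]
    exact (isProj_gren l _).le (fun j => u (c + j)) fun i j hij hj _ =>
      hu _ _ (by omega) (h3 j hj) (h4 i (hij.trans hj) j hj)
  · rw [← Finset.sum_fiberwise_of_maps_to hmaps]
    refine Finset.sum_eq_zero fun c hc => ?_
    obtain ⟨l, h1, h2, h3, h4⟩ := key c hc
    rw [h1, Finset.sum_congr rfl fun j hj => by
      rw [h2 j (Nat.le_of_lt_succ (Finset.mem_range.1 hj))]]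
    exact (isProj_gren l _).eq

end BlockGren

/-! ### Continuity and special values of the blockwise operator. -/

section BlockGren

variable {p : ℕ → ℝ} {κ : ℕ}

theorem pos_of_le (hp : Antitone p) (hκ : IsGreatest {x | 0 < p x} κ) {x : ℕ} (hx : x ≤ κ) :
    0 < p x :=
  lt_of_lt_of_le hκ.1 (hp hx)

theorem eq_zero_of_lt (hp0 : ∀ x, 0 ≤ p x) (hκ : IsGreatest {x | 0 < p x} κ) {x : ℕ}
    (hx : κ < x) : p x = 0 :=
  le_antisymm (not_lt.1 fun h => absurd (hκ.2 h) (not_le.2 hx)) (hp0 x)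

theorem abs_le_sqrt_sum (f : ℕ → ℝ) {x : ℕ} (hx : x ≤ κ) :
    |f x| ≤ √(∑ x ∈ Finset.range (κ + 1), f x ^ 2) := by
  rw [← Real.sqrt_sq_eq_abs]
  exact Real.sqrt_le_sqrt (Finset.single_le_sum (f := fun x => f x ^ 2)
    (fun _ _ => sq_nonneg _) (Finset.mem_range.2 (Nat.lt_succ_of_le hx)))

theorem continuous_blockGren (hp : Antitone p) (hκ : IsGreatest {x | 0 < p x} κ) {x : ℕ}
    (hx : x ≤ κ) : Continuous fun w : ℕ → ℝ => blockGren p w x := by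
  rw [continuous_iff_continuousAt]
  intro w
  rw [ContinuousAt, tendsto_iff_dist_tendsto_zero]
  have hc : Continuous fun w' : ℕ → ℝ => √(∑ x ∈ Finset.range (κ + 1), (w' x - w x) ^ 2) := by
    fun_prop
  have h0 := hc.tendsto w
  simp only [sub_self, ne_eq, OfNat.ofNat_ne_zero, not_false_eq_true, zero_pow,
    Finset.sum_const_zero, Real.sqrt_zero] at h0
  refine squeeze_zero (fun _ => dist_nonneg) (fun w' => ?_) h0
  rw [Real.dist_eq]
  exact (abs_le_sqrt_sum (fun x => blockGren p w' x - blockGren p w x) hx).trans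
    (Real.sqrt_le_sqrt ((isProj_blockGren hp hκ w').contraction (isProj_blockGren hp hκ w)))

theorem blockGren_congr (hp : Antitone p) (hκ : IsGreatest {x | 0 < p x} κ) {w w' : ℕ → ℝ}
    (h : ∀ x ≤ κ, w x = w' x) {x : ℕ} (hx : x ≤ κ) : blockGren p w x = blockGren p w' x := by
  have h1 := (isProj_blockGren hp hκ w).contraction (isProj_blockGren hp hκ w')
  rw [Finset.sum_eq_zero (f := fun x => (w x - w' x) ^ 2) fun x hx => by
    simp [h x (Nat.le_of_lt_succ (Finset.mem_range.1 hx))]] at h1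
  have h2 := (abs_le_sqrt_sum (fun x => blockGren p w x - blockGren p w' x) hx).trans
    (Real.sqrt_le_sqrt h1)
  rw [Real.sqrt_zero] at h2
  exact sub_eq_zero.1 (abs_nonpos_iff.1 h2)

/-- All blocks are singletons, so the cone is the whole space. -/
theorem blockGren_of_strictAntiOn (hp : Antitone p) (hκ : IsGreatest {x | 0 < p x} κ)
    (hs : StrictAntiOn p (Set.Iic κ)) (w : ℕ → ℝ) {x : ℕ} (hx : x ≤ κ) :
    blockGren p w x = w x :=
  (isProj_blockGren hp hκ w).unique
    ⟨fun _ _ hxy hy hpe => by rw [hs.injOn (hxy.trans hy) hy hpe], by simp, by simp⟩ hx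

theorem exists_eq_of_not_strictAntiOn (hp : Antitone p)
    (hs : ¬ StrictAntiOn p (Set.Iic κ)) : ∃ x y, x < y ∧ y ≤ κ ∧ p x = p y := by
  simp only [StrictAntiOn, not_forall] at hs
  obtain ⟨x, -, y, hy, hxy, h⟩ := hs
  exact ⟨x, y, hxy, hy, le_antisymm (not_lt.1 h) (hp hxy.le)⟩

/-- A vector that is increasing on a block and has zero mean there is projected to zero. -/
theorem blockGren_single_sub_single (hp : Antitone p) (hκ : IsGreatest {x | 0 < p x} κ)
    {a : ℝ} (ha : 0 ≤ a) {x y : ℕ} (hxy : x < y) (hy : y ≤ κ) (hpe : p x = p y) {z : ℕ}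
    (hz : z ≤ κ) : blockGren p (Pi.single y a - Pi.single x a : ℕ → ℝ) z = 0 := by
  refine (isProj_blockGren hp hκ _).unique (v' := 0)
    ⟨fun _ _ _ _ _ => le_rfl, fun u hu => ?_, by simp⟩ hz
  have hu' := hu x y hxy.le hy hpe
  simp only [Pi.sub_apply, Pi.zero_apply, sub_zero, sub_mul, Finset.sum_sub_distrib,
    Pi.single_apply, ite_mul, zero_mul, Finset.sum_ite_eq', Finset.mem_range]
  rw [if_pos (by omega), if_pos (by omega)]
  linarith [mul_le_mul_of_nonneg_left hu' ha]

end BlockGren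

/-! ### Second order expansion of the Hellinger distance. -/

section Hellinger

theorem hellingerSq_eq_sum {κ : ℕ} {b p : ℕ → ℝ} (hb : ∀ x, κ < x → b x = 0)
    (hp : ∀ x, κ < x → p x = 0) :
    hellingerSq b p = (1 / 2) * ∑ x ∈ Finset.range (κ + 1), (√(b x) - √(p x)) ^ 2 := by
  rw [hellingerSq, tsum_eq_sum]
  intro x hx
  have hx' : κ < x := by simpa using hx
  simp [hb x hx', hp x hx']

/-- With `a = s²` and `b = r²` the difference factors exactly as `(r - s)² (s - r) (3 s + r) / (4
s²)`, so the cubic bound holds down to `b = 0` with no smallness assumption. -/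
theorem abs_sqrt_sub_sqrt_sq_sub_le {a b : ℝ} (ha : 0 < a) (hb : 0 ≤ b) :
    |(√b - √a) ^ 2 - (b - a) ^ 2 / (4 * a)| ≤ |b - a| ^ 3 / a ^ 2 := by
  obtain ⟨s, hs, rfl⟩ : ∃ s : ℝ, 0 < s ∧ a = s ^ 2 :=
    ⟨√a, Real.sqrt_pos.2 ha, (Real.sq_sqrt ha.le).symm⟩
  obtain ⟨r, hr, rfl⟩ : ∃ r : ℝ, 0 ≤ r ∧ b = r ^ 2 :=
    ⟨√b, Real.sqrt_nonneg b, (Real.sq_sqrt hb).symm⟩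
  rw [Real.sqrt_sq hs.le, Real.sqrt_sq hr]
  have h1 : (r - s) ^ 2 - (r ^ 2 - s ^ 2) ^ 2 / (4 * s ^ 2) =
      (r - s) ^ 2 * (s - r) * (3 * s + r) / (4 * s ^ 2) := by
    field_simp; ring
  have h2 : |r ^ 2 - s ^ 2| = |s - r| * (r + s) := by
    rw [abs_sub_comm, show s ^ 2 - r ^ 2 = (s - r) * (r + s) by ring, abs_mul,
      abs_of_nonneg (show 0 ≤ r + s by linarith)]
  have h3 : |(r - s) ^ 2 * (s - r) * (3 * s + r) / (4 * s ^ 2)| =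
      |s - r| ^ 3 * ((3 * s + r) / (4 * s ^ 2)) := by
    rw [abs_div, abs_mul, abs_mul, abs_pow, abs_sub_comm r s,
      abs_of_nonneg (show 0 ≤ 3 * s + r by linarith),
      abs_of_nonneg (show 0 ≤ 4 * s ^ 2 by positivity)]
    ring
  rw [h1, h3, h2, mul_pow, mul_div_assoc]
  refine mul_le_mul_of_nonneg_left ?_ (by positivity)
  rw [div_le_div_iff₀ (by positivity) (by positivity)]
  have h4 : (3 * s + r) * (s ^ 2) ≤ (r + s) ^ 3 * 4 := by
    have : (r + s) ^ 3 = r ^ 3 + 3 * (r ^ 2 * s) + 3 * (r * s ^ 2) + s ^ 3 := by ring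
    have h5 : 0 ≤ r ^ 3 := by positivity
    have h6 : 0 ≤ r ^ 2 * s := by positivity
    have h7 : 0 ≤ r * s ^ 2 := by positivity
    have h8 : 0 ≤ s ^ 3 := by positivity
    have : (3 * s + r) * (s ^ 2) = 3 * s ^ 3 + r * s ^ 2 := by ring
    linarith
  calc (3 * s + r) * (s ^ 2) ^ 2 = (3 * s + r) * s ^ 2 * s ^ 2 := by ring
    _ ≤ (r + s) ^ 3 * 4 * s ^ 2 := mul_le_mul_of_nonneg_right h4 (by positivity)
    _ = _ := by ring

/-- Trades the cubic error for fourth powers, whose expectations are controlled later. -/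
theorem abs_pow_three_le (v : ℝ) : |v| ^ 3 ≤ 1 + (v ^ 2) ^ 2 := by
  rw [← sq_abs v]
  rcases le_total |v| 1 with h | h
  · have := pow_le_one₀ (n := 3) (abs_nonneg v) h
    have : 0 ≤ (|v| ^ 2) ^ 2 := by positivity
    linarith
  · have : |v| ^ 3 ≤ |v| ^ 4 := pow_le_pow_right₀ h (by norm_num)
    calc |v| ^ 3 ≤ |v| ^ 4 := this
      _ = (|v| ^ 2) ^ 2 := by ring
      _ ≤ 1 + (|v| ^ 2) ^ 2 := by linarith

variable {p : ℕ → ℝ} {κ : ℕ}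

/-- The second order expansion of the squared Hellinger distance. -/
theorem abs_hellingerSq_sub_le (hp : Antitone p) (hp0 : ∀ x, 0 ≤ p x)
    (hκ : IsGreatest {x | 0 < p x} κ)
    {b v : ℕ → ℝ} {s : ℝ} (hs : 0 < s) (hb0 : ∀ x ≤ κ, 0 ≤ b x) (hb : ∀ x, κ < x → b x = 0)
    (hbv : ∀ x ≤ κ, v x = s * (b x - p x)) :
    |s ^ 2 * hellingerSq b p - 1 / 8 * ∑ x ∈ Finset.range (κ + 1), v x ^ 2 / p x| ≤
      (p κ ^ 2)⁻¹ / s * (κ + 1 + (∑ x ∈ Finset.range (κ + 1), v x ^ 2) ^ 2) := by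
  have hpκ : 0 < p κ := hκ.1
  rw [hellingerSq_eq_sum hb fun x => eq_zero_of_lt hp0 hκ]
  have h1 : s ^ 2 * ((1 / 2) * ∑ x ∈ Finset.range (κ + 1), (√(b x) - √(p x)) ^ 2) -
      1 / 8 * ∑ x ∈ Finset.range (κ + 1), v x ^ 2 / p x =
      ∑ x ∈ Finset.range (κ + 1), s ^ 2 / 2 *
        ((√(b x) - √(p x)) ^ 2 - (b x - p x) ^ 2 / (4 * p x)) := by
    simp only [Finset.mul_sum, ← Finset.sum_sub_distrib]
    refine Finset.sum_congr rfl fun x hx => ?_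
    have hxκ := Nat.le_of_lt_succ (Finset.mem_range.1 hx)
    have := pos_of_le hp hκ hxκ
    rw [hbv x hxκ]
    field_simp
    ring
  have h2 : ∑ x ∈ Finset.range (κ + 1), (1 + (v x ^ 2) ^ 2) ≤
      κ + 1 + (∑ x ∈ Finset.range (κ + 1), v x ^ 2) ^ 2 := by
    rw [Finset.sum_add_distrib]
    have := Finset.sum_sq_le_sq_sum_of_nonneg (s := Finset.range (κ + 1)) (f := fun x => v x ^ 2)
      fun _ _ => sq_nonneg _
    simp only [Finset.sum_const, Finset.card_range, nsmul_eq_mul, mul_one, Nat.cast_add,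
      Nat.cast_one]
    linarith
  rw [h1]
  refine (Finset.abs_sum_le_sum_abs _ _).trans
    (le_trans ?_ (mul_le_mul_of_nonneg_left h2 (by positivity)))
  rw [Finset.mul_sum]
  refine Finset.sum_le_sum fun x hx => ?_
  have hxκ := Nat.le_of_lt_succ (Finset.mem_range.1 hx)
  have hpx := pos_of_le hp hκ hxκ
  have h3 := abs_sqrt_sub_sqrt_sq_sub_le hpx (hb0 x hxκ)
  have h4 : |v x| ^ 3 = s ^ 3 * |b x - p x| ^ 3 := by
    rw [hbv x hxκ, abs_mul, abs_of_pos hs, mul_pow]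
  rw [abs_mul, abs_of_pos (by positivity)]
  have h5 : (p x ^ 2)⁻¹ ≤ (p κ ^ 2)⁻¹ :=
    inv_anti₀ (by positivity) (pow_le_pow_left₀ hpκ.le (hp hxκ) 2)
  -- The cubic error carries `s⁻³` against the factor `s ^ 2`, which leaves the rate `1 / s`.
  calc s ^ 2 / 2 * |(√(b x) - √(p x)) ^ 2 - (b x - p x) ^ 2 / (4 * p x)|
      ≤ s ^ 2 / 2 * (|b x - p x| ^ 3 / p x ^ 2) := mul_le_mul_of_nonneg_left h3 (by positivity)
    _ = (1 / 2) * ((p x ^ 2)⁻¹ / s * |v x| ^ 3) := by rw [h4]; field_simp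
    _ ≤ (p x ^ 2)⁻¹ / s * |v x| ^ 3 := by
      have : 0 ≤ (p x ^ 2)⁻¹ / s * |v x| ^ 3 := by positivity
      linarith
    _ ≤ (p κ ^ 2)⁻¹ / s * (1 + (v x ^ 2) ^ 2) := by
      refine mul_le_mul ?_ (abs_pow_three_le _) (by positivity) (by positivity)
      exact div_le_div_of_nonneg_right h5 hs.le

/-- The least positive gap between the values of `p` on its support. -/
theorem exists_gap (hκ : IsGreatest {x | 0 < p x} κ) :
    ∃ δ : ℝ, 0 < δ ∧ δ ≤ 1 ∧ 2 * δ ≤ p κ ∧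
      ∀ x ≤ κ, ∀ y ≤ κ, p y < p x → p y + 2 * δ ≤ p x := by
  have hpκ : 0 < p κ := hκ.1
  -- The extra elements `2` and `p κ` make `S` nonempty and, after halving, give `δ ≤ 1` and `2 δ ≤
  -- p κ`. Gaps of size `2 δ` survive two perturbations smaller than `δ`.
  let S : Finset ℝ := insert 2 (insert (p κ) (((Finset.range (κ + 1) ×ˢ Finset.range (κ + 1)).filter
    fun q => p q.2 < p q.1).image fun q => p q.1 - p q.2))
  have hne : S.Nonempty := ⟨2, by simp [S]⟩
  have hpos : 0 < S.min' hne := by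
    rw [Finset.lt_min'_iff]
    intro a ha
    simp only [S, Finset.mem_insert, Finset.mem_image, Finset.mem_filter] at ha
    rcases ha with rfl | rfl | ⟨q, ⟨-, hq⟩, rfl⟩
    · norm_num
    · exact hpκ
    · linarith
  refine ⟨S.min' hne / 2, by linarith, ?_, ?_, fun x hx y hy hxy => ?_⟩
  · have := S.min'_le 2 (by simp [S])
    linarith
  · have := S.min'_le (p κ) (by simp [S])
    linarith
  · have := S.min'_le (p x - p y) (by
      simp only [S, Finset.mem_insert, Finset.mem_image, Finset.mem_filter, Finset.mem_product,
        Finset.mem_range]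
      exact Or.inr (Or.inr ⟨(x, y), ⟨⟨by omega, by omega⟩, hxy⟩, rfl⟩))
    linarith

end Hellinger

/-! ### Pathwise reduction of the three estimators to the deviation `z`. -/

section Estimators

/-- `e` is a vector of relative frequencies supported in `{0, …, κ}`, with largest atom at most
`M`. -/
structure IsFreq (κ M : ℕ) (e : ℕ → ℝ) : Prop where
  nonneg : ∀ x, 0 ≤ e x
  eq_zero : ∀ x, κ < x → e x = 0
  sum_le : ∀ k, ∑ x ∈ Finset.range k, e x ≤ 1
  le : M ≤ κ
  eq_of_pos : 0 < e κ → M = κ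

variable {p e : ℕ → ℝ} {κ M : ℕ}

theorem IsFreq.le_one (he : IsFreq κ M e) (x : ℕ) : e x ≤ 1 :=
  (Finset.single_le_sum (f := e) (fun _ _ => he.nonneg _) (Finset.self_mem_range_succ x)).trans
    (he.sum_le _)

theorem IsFreq.rear_le_one (he : IsFreq κ M e) (x : ℕ) : rear M e x ≤ 1 := by
  unfold rear
  split_ifs
  · exact he.le_one _
  · exact zero_le_one

theorem IsFreq.rear_eq_zero (he : IsFreq κ M e) {x : ℕ} (hx : κ < x) : rear M e x = 0 := by
  rw [rear, dif_neg]
  have := he.le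
  omega

theorem IsFreq.gren_eq_zero (he : IsFreq κ M e) {x : ℕ} (hx : κ < x) : gren M e x = 0 := by
  rw [gren, if_neg]
  have := he.le
  omega

/-- Projection contracts the Euclidean norm, and for frequencies `∑ e² ≤ ∑ e ≤ 1`. -/
theorem IsFreq.gren_le_one (he : IsFreq κ M e) (x : ℕ) : gren M e x ≤ 1 := by
  by_cases hx : x ≤ M
  · refine (le_abs_self _).trans ((abs_le_sqrt_sum (gren M e) hx).trans ?_)
    refine Real.sqrt_le_one.2 ?_
    refine (isProj_gren M e).norm_le.trans (le_trans ?_ (he.sum_le (M + 1)))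
    exact Finset.sum_le_sum fun x _ => by nlinarith [he.nonneg x, he.le_one x]
  · rw [gren, if_neg hx]
    exact zero_le_one

theorem hellingerSq_nonneg (b p : ℕ → ℝ) : 0 ≤ hellingerSq b p :=
  mul_nonneg (by norm_num) (tsum_nonneg fun _ => sq_nonneg _)

/-- Upper bounds on the entries suffice, since `√` vanishes on negative numbers. -/
theorem hellingerSq_le {b : ℕ → ℝ} (hp0 : ∀ x, 0 ≤ p x) (hp1 : ∀ x, p x ≤ 1)
    (hκ : IsGreatest {x | 0 < p x} κ) (hb : ∀ x, κ < x → b x = 0) (hb1 : ∀ x, b x ≤ 1) :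
    hellingerSq b p ≤ κ + 1 := by
  rw [hellingerSq_eq_sum hb fun x => eq_zero_of_lt hp0 hκ]
  have h1 : ∑ x ∈ Finset.range (κ + 1), (√(b x) - √(p x)) ^ 2 ≤
      ∑ x ∈ Finset.range (κ + 1), (1 : ℝ) := Finset.sum_le_sum fun x _ => by
    have h2 := Real.sqrt_nonneg (b x)
    have h3 := Real.sqrt_nonneg (p x)
    have h4 := Real.sqrt_le_one.2 (hb1 x)
    have h5 := Real.sqrt_le_one.2 (hp1 x)
    rw [sq_le_one_iff_abs_le_one, abs_le]
    constructor <;> linarith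
  simp only [Finset.sum_const, Finset.card_range, nsmul_eq_mul, mul_one, Nat.cast_add,
    Nat.cast_one] at h1
  have : (0 : ℝ) ≤ κ := κ.cast_nonneg
  linarith

/-- If `e` is close to `p`, rearranging `e` only permutes the entries within the blocks of `p`. -/
theorem sum_rear_eq (hp : Antitone p) {δ : ℝ}
    (hδ : ∀ x ≤ κ, ∀ y ≤ κ, p y < p x → p y + 2 * δ ≤ p x) (he : ∀ x ≤ κ, |e x - p x| < δ)
    (f : ℝ → ℝ → ℝ) :
    ∑ x ∈ Finset.range (κ + 1), f (rear κ e x) (p x) =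
      ∑ x ∈ Finset.range (κ + 1), f (e x) (p x) := by
  rw [Finset.sum_range, Finset.sum_range]
  set σ := Tuple.sort (fun i : Fin (κ + 1) => OrderDual.toDual (e i)) with hσ
  have h1 : ∀ i : Fin (κ + 1), rear κ e i = e (σ i) := fun i => by
    simp only [rear, i.2, dif_pos, hσ]
  have hmono : Monotone ((fun i : Fin (κ + 1) => OrderDual.toDual (e i)) ∘ σ) := Tuple.monotone_sort _
  -- Sorting `e` also sorts `p`: a strict inversion of `p` would mean a gap of `2 δ`, too large for
  -- `e` to undo.
  have hmono2 : Monotone ((fun i : Fin (κ + 1) => OrderDual.toDual (p i)) ∘ σ) := by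
    intro i j hij
    have h2 : e (σ j) ≤ e (σ i) := hmono hij
    change p (σ j) ≤ p (σ i)
    by_contra! hlt
    have h3 := hδ (σ j) (Nat.le_of_lt_succ (σ j).2) (σ i) (Nat.le_of_lt_succ (σ i).2) hlt
    have h4 := abs_lt.1 (he (σ j) (Nat.le_of_lt_succ (σ j).2))
    have h5 := abs_lt.1 (he (σ i) (Nat.le_of_lt_succ (σ i).2))
    linarith [h4.1, h5.2]
  have hmono3 : Monotone ((fun i : Fin (κ + 1) => OrderDual.toDual (p i)) ∘
      (1 : Equiv.Perm (Fin (κ + 1)))) := fun i j hij => hp hij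
  -- Two monotone arrangements of the same values coincide, so `σ` moves indices only inside blocks.
  have hpσ : ∀ i : Fin (κ + 1), p (σ i) = p i := fun i =>
    congrFun (Tuple.unique_monotone hmono2 hmono3) i
  rw [← Equiv.sum_comp σ fun i : Fin (κ + 1) => f (e i) (p i)]
  exact Finset.sum_congr rfl fun i _ => by rw [h1, hpσ]

/-- If `e` is close to `p`, the Grenander operator acts on `e - p` block by block. -/
theorem gren_eq_add_blockGren (hp : Antitone p) (hκ : IsGreatest {x | 0 < p x} κ) {δ s : ℝ}
    (hs : 0 < s) (hδ : ∀ x ≤ κ, ∀ y ≤ κ, p y < p x → p y + 2 * δ ≤ p x) {z : ℕ → ℝ}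
    (hz : ∀ x ≤ κ, z x = s * (e x - p x)) (hv : ∀ x ≤ κ, |blockGren p z x| < δ * s) {x : ℕ}
    (hx : x ≤ κ) : gren κ e x = p x + blockGren p z x / s := by
  have hproj := isProj_blockGren hp hκ z
  set v := blockGren p z
  have hsum : ∀ u : ℕ → ℝ, ∑ x ∈ Finset.range (κ + 1), (e x - (p x + v x / s)) * u x =
      s⁻¹ * ∑ x ∈ Finset.range (κ + 1), (z x - v x) * u x := fun u => by
    rw [Finset.mul_sum]
    refine Finset.sum_congr rfl fun x hx => ?_
    rw [hz x (Nat.le_of_lt_succ (Finset.mem_range.1 hx))]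
    field_simp
    ring
  -- It is enough that `p + v / s` satisfies the conditions characterising the projection.
  -- Deviations below `δ` cannot close a gap of `2 δ`, and a decreasing test vector is in particular
  -- decreasing on blocks.
  refine IsProj.gren_eq (v := fun x => p x + v x / s) ⟨fun x y hxy hy _ => ?_, fun u hu => ?_, ?_⟩ hx
  · rcases (hp hxy).lt_or_eq with hlt | heq
    · have h1 := hδ x (hxy.trans hy) y hy hlt
      have h2 := (abs_lt.1 (hv x (hxy.trans hy))).1
      have h3 := (abs_lt.1 (hv y hy)).2
      have h4 : v y / s < δ := (div_lt_iff₀ hs).2 h3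
      have h5 : -δ < v x / s := (lt_div_iff₀ hs).2 (by linarith)
      linarith
    · have := div_le_div_of_nonneg_right (hproj.anti x y hxy hy heq.symm) hs.le
      linarith
  · rw [hsum]
    exact mul_nonpos_of_nonneg_of_nonpos (by positivity)
      (hproj.le u fun x y hxy hy _ => hu x y hxy hy rfl)
  · rw [hsum]
    -- Both `p` and `-p` lie in the blockwise cone, so the residual `z - v` is orthogonal to `p`.
    have h1 := hproj.le p fun x y hxy hy _ => hp hxy
    have h2 := hproj.le (fun x => -p x) fun x y hxy hy h => by simp [h]
    simp only [mul_neg, Finset.sum_neg_distrib] at h2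
    have h3 : ∑ x ∈ Finset.range (κ + 1), (z x - v x) * (p x + v x / s) =
        ∑ x ∈ Finset.range (κ + 1), (z x - v x) * p x +
        s⁻¹ * ∑ x ∈ Finset.range (κ + 1), (z x - v x) * v x := by
      rw [Finset.mul_sum, ← Finset.sum_add_distrib]
      exact Finset.sum_congr rfl fun x _ => by ring
    rw [h3, hproj.eq, le_antisymm h1 (by linarith)]
    simp

/-- The three rescaled squared Hellinger distances are close to the quadratic forms of
`z = s (e - p)`. -/
theorem exists_abs_hellingerSq_sub_le (hp : Antitone p) (hp0 : ∀ x, 0 ≤ p x) (hp1 : ∀ x, p x ≤ 1)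
    (hκ : IsGreatest {x | 0 < p x} κ) :
    ∃ C : ℝ, 0 ≤ C ∧ ∀ (s : ℝ) (M : ℕ) (e z : ℕ → ℝ), 1 ≤ s → IsFreq κ M e →
      (∀ x ≤ κ, z x = s * (e x - p x)) →
      |s ^ 2 * hellingerSq e p - 1 / 8 * ∑ x ∈ Finset.range (κ + 1), z x ^ 2 / p x| ≤
        C / s * (κ + 1 + (∑ x ∈ Finset.range (κ + 1), z x ^ 2) ^ 2) ∧
      |s ^ 2 * hellingerSq (rear M e) p - 1 / 8 * ∑ x ∈ Finset.range (κ + 1), z x ^ 2 / p x| ≤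
        C / s * (κ + 1 + (∑ x ∈ Finset.range (κ + 1), z x ^ 2) ^ 2) ∧
      |s ^ 2 * hellingerSq (gren M e) p -
          1 / 8 * ∑ x ∈ Finset.range (κ + 1), blockGren p z x ^ 2 / p x| ≤
        C / s * (κ + 1 + (∑ x ∈ Finset.range (κ + 1), z x ^ 2) ^ 2) := by
  obtain ⟨δ, hδ0, hδ1, hδκ, hδ⟩ := exists_gap hκ
  have hpκ : 0 < p κ := hκ.1
  have hκ0 : (0 : ℝ) ≤ κ := κ.cast_nonneg
  -- The first constant serves the second order expansion, the second the case where `e` is far from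
  -- `p`.
  refine ⟨max (p κ ^ 2)⁻¹ ((κ + 1) * (p κ)⁻¹ * (δ ^ 4)⁻¹), by positivity, ?_⟩
  intro s M e z hs he hz
  have hs0 : 0 < s := by linarith
  set Q := (∑ x ∈ Finset.range (κ + 1), z x ^ 2) ^ 2 with hQ
  have hQ0 : 0 ≤ Q := sq_nonneg _
  set C := max (p κ ^ 2)⁻¹ ((κ + 1) * (p κ)⁻¹ * (δ ^ 4)⁻¹)
  have hC1 : ∀ q, 0 ≤ q → (p κ ^ 2)⁻¹ / s * q ≤ C / s * q := fun q hq =>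
    mul_le_mul_of_nonneg_right (div_le_div_of_nonneg_right (le_max_left _ _) hs0.le) hq
  have hD := (abs_hellingerSq_sub_le hp hp0 hκ hs0 (fun x _ => he.nonneg x) he.eq_zero hz).trans
    (hC1 _ (by positivity))
  have hproj := isProj_blockGren hp hκ z
  refine ⟨hD, ?_⟩
  by_cases hA : ∑ x ∈ Finset.range (κ + 1), z x ^ 2 < (δ * s) ^ 2
  · have hsq : √(∑ x ∈ Finset.range (κ + 1), z x ^ 2) < δ * s :=
      (Real.sqrt_lt' (by positivity)).2 hA
    have hz' : ∀ x ≤ κ, |e x - p x| < δ := fun x hx => by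
      have h1 := (abs_le_sqrt_sum z hx).trans_lt hsq
      rw [hz x hx, abs_mul, abs_of_pos hs0, mul_comm] at h1
      exact lt_of_mul_lt_mul_right h1 hs0.le
    have hv : ∀ x ≤ κ, |blockGren p z x| < δ * s := fun x hx =>
      ((abs_le_sqrt_sum (blockGren p z) hx).trans (Real.sqrt_le_sqrt hproj.norm_le)).trans_lt hsq
    -- Here `e κ > p κ - δ > 0`, so `κ` has been observed and the estimators act on all of `{0, …,
    -- κ}`.
    have hM : M = κ := he.eq_of_pos (by
      have := (abs_lt.1 (hz' κ le_rfl)).1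
      linarith)
    subst hM
    have hbv := fun x (hx : x ≤ M) => gren_eq_add_blockGren hp hκ hs0 hδ hz hv hx
    constructor
    · rw [hellingerSq_eq_sum (fun x hx => he.rear_eq_zero hx) fun x => eq_zero_of_lt hp0 hκ,
        sum_rear_eq hp hδ hz' fun a b => (√a - √b) ^ 2, ← hellingerSq_eq_sum he.eq_zero
        fun x => eq_zero_of_lt hp0 hκ]
      exact hD
    · refine (abs_hellingerSq_sub_le hp hp0 hκ hs0 (fun x hx => ?_)
        (fun x hx => he.gren_eq_zero hx) fun x hx => ?_).trans
        ((hC1 _ (by positivity)).trans (mul_le_mul_of_nonneg_left ?_ (by positivity)))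
      · rw [hbv x hx]
        have h1 : -δ < blockGren p z x / s :=
          (lt_div_iff₀ hs0).2 (by linarith [(abs_lt.1 (hv x hx)).1])
        linarith [hp hx]
      · rw [hbv x hx]
        field_simp
        ring
      · have := pow_le_pow_left₀ (Finset.sum_nonneg fun _ _ => sq_nonneg _) hproj.norm_le 2
        linarith
  · rw [not_lt] at hA
    have hA2 : δ ^ 4 * s ^ 4 ≤ Q := by
      have := pow_le_pow_left₀ (by positivity) hA 2
      calc δ ^ 4 * s ^ 4 = ((δ * s) ^ 2) ^ 2 := by ring
        _ ≤ Q := this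
    have hf : ∑ x ∈ Finset.range (κ + 1), z x ^ 2 / p x ≤ s ^ 2 * ((κ + 1) * (p κ)⁻¹) := by
      have h1 : ∀ x ∈ Finset.range (κ + 1), z x ^ 2 / p x ≤ s ^ 2 * (p κ)⁻¹ := fun x hx => by
        have hxκ := Nat.le_of_lt_succ (Finset.mem_range.1 hx)
        have hpx := pos_of_le hp hκ hxκ
        rw [hz x hxκ, mul_pow, mul_div_assoc]
        refine mul_le_mul_of_nonneg_left ?_ (sq_nonneg _)
        rw [div_eq_mul_inv]
        refine (mul_le_mul (b := 1) ?_ (inv_anti₀ hpκ (hp hxκ)) (by positivity) zero_le_one).trans_eq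
          (one_mul _)
        rw [sq_le_one_iff_abs_le_one, abs_le]
        constructor <;> linarith [he.nonneg x, he.le_one x, hp1 x]
      refine (Finset.sum_le_sum h1).trans_eq ?_
      simp only [Finset.sum_const, Finset.card_range, nsmul_eq_mul]
      push_cast
      ring
    -- Far from `p` one has `Q ≥ δ⁴ s⁴`, which absorbs the crude bound of order `s ^ 2`; `1 ≤ s`
    -- then relaxes `1 / s ^ 2` to `1 / s`.
    have hbig : s ^ 2 * ((κ + 1) * (p κ)⁻¹) ≤ C / s * (κ + 1 + Q) := by
      have h1 : s ^ 2 * ((κ + 1) * (p κ)⁻¹) ≤ ((κ + 1) * (p κ)⁻¹ * (δ ^ 4)⁻¹) / s ^ 2 * Q := by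
        calc s ^ 2 * ((κ + 1) * (p κ)⁻¹)
            = ((κ + 1) * (p κ)⁻¹ * (δ ^ 4)⁻¹) / s ^ 2 * (δ ^ 4 * s ^ 4) := by field_simp
          _ ≤ _ := mul_le_mul_of_nonneg_left hA2 (by positivity)
      refine h1.trans (mul_le_mul (div_le_div₀ (by positivity) (le_max_right _ _) hs0 ?_)
        (by linarith) hQ0 (by positivity))
      nlinarith
    have hcomb : ∀ b v : ℕ → ℝ, (∀ x, κ < x → b x = 0) → (∀ x, b x ≤ 1) →
        ∑ x ∈ Finset.range (κ + 1), v x ^ 2 / p x ≤ ∑ x ∈ Finset.range (κ + 1), z x ^ 2 / p x →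
        |s ^ 2 * hellingerSq b p - 1 / 8 * ∑ x ∈ Finset.range (κ + 1), v x ^ 2 / p x| ≤
        C / s * (κ + 1 + Q) := by
      intro b v hb hb1 hvz
      have h1 := hellingerSq_le hp0 hp1 hκ hb hb1
      have h2 := hellingerSq_nonneg b p
      have h3 : 0 ≤ ∑ x ∈ Finset.range (κ + 1), v x ^ 2 / p x :=
        Finset.sum_nonneg fun x _ => div_nonneg (sq_nonneg _) (hp0 x)
      have h4 : (1 : ℝ) ≤ (p κ)⁻¹ := (one_le_inv₀ hpκ).2 (hp1 κ)
      have h5 : s ^ 2 * hellingerSq b p ≤ s ^ 2 * ((κ + 1) * (p κ)⁻¹) :=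
        mul_le_mul_of_nonneg_left (h1.trans (le_mul_of_one_le_right (by positivity) h4))
          (sq_nonneg _)
      have h6 : 0 ≤ s ^ 2 * hellingerSq b p := by positivity
      rw [abs_le]
      constructor <;> linarith
    exact ⟨hcomb _ z (fun x hx => he.rear_eq_zero hx) he.rear_le_one le_rfl,
      hcomb _ _ (fun x hx => he.gren_eq_zero hx) he.gren_le_one (hproj.weighted_norm_le hp hpκ)⟩

end Estimators

/-! ### Tools for convergence in distribution and in mean. -/

section Convergence

variable {Ω Ω' : Type*} [MeasurableSpace Ω] [MeasurableSpace Ω']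
  {P : Measure Ω} [IsProbabilityMeasure P] {P' : Measure Ω'} [IsProbabilityMeasure P']

theorem charFun_map_inner {S E : Type*} [MeasurableSpace S] {μ : Measure S} [NormedAddCommGroup E]
    [InnerProductSpace ℝ E] [FiniteDimensional ℝ E] [MeasurableSpace E] [BorelSpace E] {V : S → E}
    (hV : AEMeasurable V μ) (t : E) :
    charFun (μ.map V) t = charFun (μ.map fun ω => inner ℝ (V ω) t) 1 := by
  have h : AEMeasurable (fun ω => inner ℝ (V ω) t) μ :=
    (show Measurable fun x : E => inner ℝ x t by fun_prop).comp_aemeasurable hV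
  rw [charFun_apply, charFun_apply_real, integral_map hV (by fun_prop),
    integral_map h (by fun_prop)]
  simp

/-- **Cramér–Wold device**. -/
theorem tendstoInDistribution_of_forall_inner {E : Type*} [NormedAddCommGroup E]
    [InnerProductSpace ℝ E] [FiniteDimensional ℝ E] [MeasurableSpace E] [BorelSpace E]
    {Z : ℕ → Ω → E} {Z' : Ω' → E} (hZ : ∀ n, AEMeasurable (Z n) P) (hZ' : AEMeasurable Z' P')
    (h : ∀ t : E, TendstoInDistribution (fun n ω => inner ℝ (Z n ω) t) atTop
      (fun ω => inner ℝ (Z' ω) t) (fun _ => P) P') :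
    TendstoInDistribution Z atTop Z' (fun _ => P) P' where
  forall_aemeasurable := hZ
  aemeasurable_limit := hZ'
  tendsto := by
    refine ProbabilityMeasure.tendsto_iff_tendsto_charFun.2 fun t => ?_
    have h1 := ProbabilityMeasure.tendsto_iff_tendsto_charFun.1 (h t).tendsto 1
    simpa only [ProbabilityMeasure.coe_mk, charFun_map_inner (hZ _), charFun_map_inner hZ'] using h1

/-- Truncation of the absolute value, as a bounded continuous function. -/
noncomputable def truncAbs (K : ℝ) : BoundedContinuousFunction ℝ ℝ :=
  BoundedContinuousFunction.ofNormedAddCommGroup (fun x => min |x| |K|) (by fun_prop) |K| fun x => by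
    rw [Real.norm_eq_abs, abs_of_nonneg (by positivity)]
    exact min_le_right _ _

theorem truncAbs_apply (K x : ℝ) : truncAbs K x = min |x| |K| := rfl

theorem tendsto_integral_comp_of_tendstoInDistribution {F : ℕ → Ω → ℝ} {G : Ω' → ℝ}
    (h : TendstoInDistribution F atTop G (fun _ => P) P') (g : BoundedContinuousFunction ℝ ℝ) :
    Tendsto (fun n => ∫ ω, g (F n ω) ∂P) atTop (𝓝 (∫ ω, g (G ω) ∂P')) := by
  have h1 := ProbabilityMeasure.tendsto_iff_forall_integral_tendsto.1 h.tendsto g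
  simp only [ProbabilityMeasure.coe_mk] at h1
  rw [integral_map h.aemeasurable_limit (by fun_prop)] at h1
  refine h1.congr fun n => ?_
  rw [integral_map (h.forall_aemeasurable n) (by fun_prop)]

/-- Convergence in distribution with bounded second moments implies convergence of the means. -/
theorem tendsto_integral_of_tendstoInDistribution {F : ℕ → Ω → ℝ} {G : Ω' → ℝ}
    (h : TendstoInDistribution F atTop G (fun _ => P) P') (hF0 : ∀ n ω, 0 ≤ F n ω)
    (hG0 : ∀ ω, 0 ≤ G ω) (hG : Integrable G P') (hF : ∀ n, Integrable (F n) P)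
    (hF2 : ∀ n, Integrable (fun ω => F n ω ^ 2) P) {C : ℝ} (hC : ∀ n, ∫ ω, F n ω ^ 2 ∂P ≤ C) :
    Tendsto (fun n => ∫ ω, F n ω ∂P) atTop (𝓝 (∫ ω, G ω ∂P')) := by
  have hC0 : 0 ≤ C := (integral_nonneg fun ω => sq_nonneg (F 0 ω)).trans (hC 0)
  have hint : ∀ K n, Integrable (fun ω => truncAbs K (F n ω)) P := fun K n =>
    Integrable.of_bound ((truncAbs K).continuous.comp_aestronglyMeasurable
      (hF n).aestronglyMeasurable) |K| (ae_of_all _ fun ω => by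
      rw [truncAbs_apply, Real.norm_eq_abs, abs_of_nonneg (by positivity)]
      exact min_le_right _ _)
  have h1 : ∀ K : ℝ, 0 < K → ∀ n, |∫ ω, F n ω ∂P - ∫ ω, truncAbs K (F n ω) ∂P| ≤ C / K := by
    intro K hK n
    rw [← integral_sub (hF n) (hint K n)]
    -- The part of `F` above level `K` is at most `F² / K`, so bounded second moments make the
    -- truncation error uniform in `n`.
    have h2 : ∀ ω, 0 ≤ F n ω - truncAbs K (F n ω) ∧
        F n ω - truncAbs K (F n ω) ≤ F n ω ^ 2 / K := by
      intro ω
      rw [truncAbs_apply, abs_of_nonneg (hF0 n ω), abs_of_pos hK]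
      refine ⟨sub_nonneg.2 (min_le_left _ _), ?_⟩
      rcases le_total (F n ω) K with h3 | h3
      · rw [min_eq_left h3, sub_self]
        positivity
      · rw [min_eq_right h3, le_div_iff₀ hK]
        nlinarith [hF0 n ω]
    rw [abs_of_nonneg (integral_nonneg fun ω => (h2 ω).1)]
    refine (integral_mono ((hF n).sub (hint K n)) ((hF2 n).div_const K) fun ω => (h2 ω).2).trans ?_
    rw [integral_div]
    exact div_le_div_of_nonneg_right (hC n) hK.le
  have h2 : Tendsto (fun j : ℕ => ∫ ω, truncAbs j (G ω) ∂P') atTop (𝓝 (∫ ω, G ω ∂P')) := by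
    refine tendsto_integral_of_dominated_convergence G (fun j =>
      (truncAbs j).continuous.comp_aestronglyMeasurable hG.aestronglyMeasurable) hG
      (fun j => ae_of_all _ fun ω => ?_) (ae_of_all _ fun ω => ?_)
    · rw [truncAbs_apply, Real.norm_eq_abs, abs_of_nonneg (by positivity)]
      exact (min_le_left _ _).trans_eq (abs_of_nonneg (hG0 ω))
    · obtain ⟨m, hm⟩ := exists_nat_ge (G ω)
      refine tendsto_const_nhds.congr' ?_
      filter_upwards [eventually_ge_atTop m] with j hj
      rw [truncAbs_apply, abs_of_nonneg (hG0 ω), Nat.abs_cast, min_eq_left]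
      exact hm.trans (by exact_mod_cast hj)
  rw [Metric.tendsto_atTop]
  intro ε hε
  have h3 : Tendsto (fun j : ℕ => C / (j : ℝ)) atTop (𝓝 0) :=
    tendsto_const_div_atTop_nhds_zero_nat C
  obtain ⟨j, hj1, hj2, hj3⟩ := ((h3.eventually (gt_mem_nhds (show 0 < ε / 3 by linarith))).and
    ((Metric.tendsto_nhds.1 h2 (ε / 3) (by linarith)).and (eventually_gt_atTop 0))).exists
  obtain ⟨N, hN⟩ := Metric.tendsto_atTop.1
    (tendsto_integral_comp_of_tendstoInDistribution h (truncAbs j)) (ε / 3) (by linarith)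
  refine ⟨N, fun n hn => ?_⟩
  have h4 := h1 j (by exact_mod_cast hj3) n
  have h5 := hN n hn
  rw [Real.dist_eq] at hj2 h5 ⊢
  have h6 := (abs_le.1 h4)
  have h7 := abs_lt.1 h5
  have h8 := abs_lt.1 hj2
  rw [abs_lt]
  constructor <;> linarith [h6.1, h6.2, h7.1, h7.2, h8.1, h8.2]

/-- An error that is small in mean does not affect the limits. -/
theorem tendsto_of_integral_error {F T R : ℕ → Ω → ℝ} {G : Ω' → ℝ}
    (h : TendstoInDistribution F atTop G (fun _ => P) P')
    (hF : ∀ n, Integrable (F n) P) (hT : ∀ n, Integrable (T n) P) (hR : ∀ n, Integrable (R n) P)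
    (hmean : Tendsto (fun n => ∫ ω, F n ω ∂P) atTop (𝓝 (∫ ω, G ω ∂P')))
    (hle : ∀ᶠ n in atTop, ∀ᵐ ω ∂P, |T n ω - F n ω| ≤ R n ω)
    (hR0 : Tendsto (fun n => ∫ ω, R n ω ∂P) atTop (𝓝 0)) :
    TendstoInDistribution T atTop G (fun _ => P) P' ∧
      Tendsto (fun n => ∫ ω, T n ω ∂P) atTop (𝓝 (∫ ω, G ω ∂P')) := by
  have h0 : Tendsto (fun n => ∫ ω, |T n ω - F n ω| ∂P) atTop (𝓝 0) := by
    refine squeeze_zero' (Eventually.of_forall fun n => integral_nonneg fun ω => abs_nonneg _)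
      ?_ hR0
    filter_upwards [hle] with n hn
    exact integral_mono_ae ((hT n).sub (hF n)).abs (hR n) hn
  constructor
  · refine tendstoInDistribution_of_tendstoInMeasure_sub T G h ?_ fun n => (hT n).aemeasurable
    refine tendstoInMeasure_of_tendsto_eLpNorm one_ne_zero
      (fun n => ((hT n).sub (hF n)).aestronglyMeasurable) aestronglyMeasurable_zero ?_
    have h1 : ∀ n, eLpNorm ((T - F) n - 0) 1 P = ENNReal.ofReal (∫ ω, |T n ω - F n ω| ∂P) := by
      intro n
      rw [sub_zero, eLpNorm_one_eq_lintegral_enorm,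
        ofReal_integral_eq_lintegral_ofReal (f := fun ω => |T n ω - F n ω|)
          ((hT n).sub (hF n)).abs (ae_of_all _ fun ω => abs_nonneg _)]
      refine lintegral_congr fun ω => ?_
      rw [← Real.norm_eq_abs, ofReal_norm]
      rfl
    simp only [h1]
    simpa using ENNReal.tendsto_ofReal h0
  · have h1 : Tendsto (fun n => ∫ ω, (T n ω - F n ω) ∂P) atTop (𝓝 0) :=
      squeeze_zero_norm (fun n => norm_integral_le_integral_norm _) h0
    have h2 := hmean.add h1
    rw [add_zero] at h2
    refine h2.congr fun n => ?_
    rw [integral_sub (hT n) (hF n)]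
    ring

end Convergence

/-! ### Moments of the empirical process. -/

section Empirical

variable {Ω : Type*} [MeasurableSpace Ω] {P : Measure Ω}
  {p : ℕ → ℝ} {X : ℕ → Ω → ℕ}

theorem measurable_indicator (hX : ∀ i, Measurable (X i)) (i x : ℕ) :
    Measurable fun ω => if X i ω = x then (1 : ℝ) else 0 :=
  (measurable_of_countable fun m : ℕ => if m = x then (1 : ℝ) else 0).comp (hX i)

theorem integral_indicator_eq (hX : ∀ i, Measurable (X i))
    (hlaw : ∀ i x, P.real {ω | X i ω = x} = p x) (i x : ℕ) :
    ∫ ω, (if X i ω = x then (1 : ℝ) else 0) ∂P = p x := by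
  have hm : MeasurableSet {ω | X i ω = x} := hX i (measurableSet_singleton x)
  rw [← hlaw i x, ← integral_indicator_one hm]
  refine integral_congr_ae (ae_of_all _ fun ω => ?_)
  by_cases h : X i ω = x <;> simp [h]

theorem memLp_indicator [IsProbabilityMeasure P] (hX : ∀ i, Measurable (X i)) (i x : ℕ) :
    MemLp (fun ω => if X i ω = x then (1 : ℝ) else 0) 2 P :=
  MemLp.of_bound (measurable_indicator hX i x).aestronglyMeasurable 1
    (ae_of_all _ fun ω => by split_ifs <;> simp)

theorem covariance_indicator [IsProbabilityMeasure P] (hX : ∀ i, Measurable (X i))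
    (hlaw : ∀ i x, P.real {ω | X i ω = x} = p x) (i x y : ℕ) :
    cov[fun ω => if X i ω = x then (1 : ℝ) else 0, fun ω => if X i ω = y then (1 : ℝ) else 0; P] =
      (if x = y then p x else 0) - p x * p y := by
  rw [covariance_eq_sub (memLp_indicator hX i x) (memLp_indicator hX i y),
    integral_indicator_eq hX hlaw, integral_indicator_eq hX hlaw]
  congr 1
  split_ifs with h
  · subst h
    rw [← integral_indicator_eq hX hlaw i x]
    refine integral_congr_ae (ae_of_all _ fun ω => ?_)
    by_cases h : X i ω = x <;> simp [h]
  · rw [integral_congr_ae (g := fun _ => 0) (ae_of_all _ fun ω => ?_), integral_zero]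
    by_cases h1 : X i ω = x
    · have h2 : X i ω ≠ y := fun h2 => h (h1.symm.trans h2)
      simp [h2]
    · simp [h1]

/-- The rescaled deviation of the empirical estimator. -/
noncomputable def empiricalProcess (p : ℕ → ℝ) (X : ℕ → Ω → ℕ) (n : ℕ) (ω : Ω) (x : ℕ) : ℝ :=
  √n * (empirical X n ω x - p x)

theorem empiricalProcess_eq {Ω : Type*} {p : ℕ → ℝ} {X : ℕ → Ω → ℕ} (n : ℕ) (ω : Ω) (x : ℕ) :
    empiricalProcess p X n ω x =
      (√n)⁻¹ * ∑ i ∈ Finset.range n, ((if X i ω = x then (1 : ℝ) else 0) - p x) := by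
  rw [empiricalProcess, empirical, Finset.sum_sub_distrib, Finset.sum_const, Finset.card_range,
    nsmul_eq_mul]
  rcases Nat.eq_zero_or_pos n with rfl | hn
  · simp
  · have h1 : (0 : ℝ) < n := by exact_mod_cast hn
    have h2 : 0 < √(n : ℝ) := Real.sqrt_pos.2 h1
    have h3 : (n : ℝ) = √n ^ 2 := (Real.sq_sqrt h1.le).symm
    set s := √(n : ℝ)
    rw [h3]
    field_simp

theorem measurable_empiricalProcess (hX : ∀ i, Measurable (X i)) (n x : ℕ) :
    Measurable fun ω => empiricalProcess p X n ω x := by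
  simp only [empiricalProcess_eq]
  exact (Finset.measurable_fun_sum _ fun i _ =>
    (measurable_indicator hX i x).sub_const _).const_mul _

/-- The fourth term of the exponential series bounds `|x|⁴ / 4!`, so exponential moments control
fourth moments. -/
theorem pow_four_le_exp (x : ℝ) : x ^ 4 ≤ 24 * (Real.exp x + Real.exp (-x)) := by
  have h := Real.pow_div_factorial_le_exp |x| (abs_nonneg x) 4
  have h1 : Real.exp |x| ≤ Real.exp x + Real.exp (-x) := by
    rcases abs_choice x with h2 | h2 <;> rw [h2] <;> linarith [Real.exp_pos x, Real.exp_pos (-x)]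
  rw [show |x| ^ 4 = x ^ 4 by rw [show 4 = 2 * 2 from rfl, pow_mul, sq_abs, pow_mul],
    show ((Nat.factorial 4 : ℕ) : ℝ) = 24 by norm_num [Nat.factorial], div_le_iff₀ (by norm_num)] at h
  linarith

/-- The fourth moments of the empirical process are bounded. -/
theorem integral_empiricalProcess_pow_four_le [IsProbabilityMeasure P] (hX : ∀ i, Measurable (X i)) (hind : iIndepFun X P)
    (hlaw : ∀ i x, P.real {ω | X i ω = x} = p x) (n x : ℕ) :
    Integrable (fun ω => empiricalProcess p X n ω x ^ 4) P ∧
      ∫ ω, empiricalProcess p X n ω x ^ 4 ∂P ≤ 48 * Real.exp 1 := by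
  -- Hoeffding's lemma: a centred indicator is sub-Gaussian with variance proxy `1/4`. After
  -- division by `√n` the sum has log-moment generating function at most `t² / 8`, whatever `n`.
  have hsub : ∀ i, HasSubgaussianMGF
      (fun ω => (if X i ω = x then (1 : ℝ) else 0) - p x) ((‖(1 : ℝ) - 0‖₊ / 2) ^ 2) P := fun i => by
    have := hasSubgaussianMGF_of_mem_Icc (μ := P) (a := 0) (b := 1)
      (measurable_indicator hX i x).aemeasurable
      (ae_of_all _ fun ω => by split_ifs <;> simp)
    rwa [integral_indicator_eq hX hlaw] at this
  have hind' : iIndepFun (fun i ω => (if X i ω = x then (1 : ℝ) else 0) - p x) P :=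
    hind.comp (fun _ m => (if m = x then (1 : ℝ) else 0) - p x) fun _ => measurable_of_countable _
  have hsum := HasSubgaussianMGF.sum_of_iIndepFun hind' (s := Finset.range n) fun i _ => hsub i
  have hexp : ∀ t : ℝ, |t| ≤ 1 → Integrable (fun ω => Real.exp (t * empiricalProcess p X n ω x)) P ∧
      ∫ ω, Real.exp (t * empiricalProcess p X n ω x) ∂P ≤ Real.exp 1 := by
    intro t ht
    simp only [empiricalProcess_eq, ← mul_assoc]
    refine ⟨hsum.integrable_exp_mul _, (hsum.mgf_le _).trans (Real.exp_le_exp.2 ?_)⟩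
    have h1 : ((∑ i ∈ Finset.range n, (‖(1 : ℝ) - 0‖₊ / 2) ^ 2 : NNReal) : ℝ) = n * (1 / 4) := by
      simp only [sub_zero, nnnorm_one, Finset.sum_const, Finset.card_range, nsmul_eq_mul]
      push_cast
      ring
    have h2 : t ^ 2 ≤ 1 := (sq_le_one_iff_abs_le_one t).2 ht
    rw [h1, mul_pow, inv_pow, Real.sq_sqrt (Nat.cast_nonneg n)]
    rcases Nat.eq_zero_or_pos n with rfl | hn
    · simp
    · have : (0 : ℝ) < n := by exact_mod_cast hn
      have h3 : (n : ℝ) * (1 / 4) * (t ^ 2 * (n : ℝ)⁻¹) / 2 = t ^ 2 / 8 := by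
        field_simp
        ring
      rw [h3]
      linarith
  obtain ⟨h1, h2⟩ := hexp 1 (by simp)
  obtain ⟨h3, h4⟩ := hexp (-1) (by simp)
  simp only [one_mul, neg_one_mul] at h1 h2 h3 h4
  have hI := (h1.add h3).const_mul 24
  have hle := fun ω => pow_four_le_exp (empiricalProcess p X n ω x)
  have hI4 : Integrable (fun ω => empiricalProcess p X n ω x ^ 4) P :=
    hI.mono' ((measurable_empiricalProcess hX n x).pow_const 4).aestronglyMeasurable
      (ae_of_all _ fun ω => by
        rw [Real.norm_eq_abs, abs_of_nonneg (by positivity)]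
        exact hle ω)
  refine ⟨hI4, (integral_mono hI4 hI hle).trans ?_⟩
  simp only [Pi.add_apply]
  rw [integral_const_mul, integral_add h1 h3]
  linarith

/-- The vector `(y_0, …, y_κ)` as an element of the Euclidean space. -/
noncomputable def toVec (κ : ℕ) (y : ℕ → ℝ) : EuclideanSpace ℝ (Fin (κ + 1)) :=
  WithLp.toLp 2 fun i => y i

/-- Extension of a vector by zero. -/
noncomputable def ofVec (κ : ℕ) (z : EuclideanSpace ℝ (Fin (κ + 1))) (x : ℕ) : ℝ :=
  if h : x < κ + 1 then z ⟨x, h⟩ else 0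

theorem ofVec_toVec (κ : ℕ) (y : ℕ → ℝ) {x : ℕ} (hx : x ≤ κ) : ofVec κ (toVec κ y) x = y x := by
  simp [ofVec, toVec, Nat.lt_succ_of_le hx]

theorem ofVec_coe (κ : ℕ) (z : EuclideanSpace ℝ (Fin (κ + 1))) (i : Fin (κ + 1)) :
    ofVec κ z i = z i := by
  simp only [ofVec, i.2, dif_pos]

theorem continuous_ofVec (κ : ℕ) : Continuous (ofVec κ) := by
  refine continuous_pi fun x => ?_
  unfold ofVec
  split_ifs
  · fun_prop
  · exact continuous_const

theorem inner_toVec (κ : ℕ) (y : ℕ → ℝ) (t : EuclideanSpace ℝ (Fin (κ + 1))) :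
    inner ℝ (toVec κ y) t = ∑ x ∈ Finset.range (κ + 1), ofVec κ t x * y x := by
  rw [PiLp.inner_apply, Finset.sum_range]
  refine Finset.sum_congr rfl fun i _ => ?_
  simp [toVec, ofVec_coe]

theorem aemeasurable_toVec {κ : ℕ} {V : Ω → ℕ → ℝ} (hV : ∀ x, AEMeasurable (fun ω => V ω x) P) :
    AEMeasurable (fun ω => toVec κ (V ω)) P := by
  refine (WithLp.measurable_toLp 2 _).comp_aemeasurable ?_
  exact aemeasurable_pi_lambda _ fun i => hV i

end Empirical

/-! ### Linear forms under the multinomial covariance. -/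

section Linear

variable {Ω : Type*} [MeasurableSpace Ω] {P : Measure Ω} {p : ℕ → ℝ}

theorem memLp_linear {V : ℕ → Ω → ℝ} (hV : ∀ x, MemLp (V x) 2 P) (s : Finset ℕ) (a : ℕ → ℝ) :
    MemLp (fun ω => ∑ x ∈ s, a x * V x ω) 2 P :=
  memLp_finsetSum _ fun x _ => (hV x).const_mul (a x)

/-- Covariance of linear forms in variables with the multinomial covariance structure. -/
theorem covariance_linear [IsFiniteMeasure P] {V : ℕ → Ω → ℝ} (hV : ∀ x, MemLp (V x) 2 P)
    (hc : ∀ x y, cov[V x, V y; P] = (if x = y then p x else 0) - p x * p y) (s : Finset ℕ)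
    (a b : ℕ → ℝ) :
    cov[fun ω => ∑ x ∈ s, a x * V x ω, fun ω => ∑ x ∈ s, b x * V x ω; P] =
      ∑ x ∈ s, a x * b x * p x - (∑ x ∈ s, a x * p x) * ∑ x ∈ s, b x * p x := by
  rw [covariance_fun_sum_fun_sum' (X := fun x ω => a x * V x ω) (Y := fun x ω => b x * V x ω)
    (fun x _ => (hV x).const_mul (a x)) (fun x _ => (hV x).const_mul (b x)), Finset.sum_mul_sum,
    ← Finset.sum_sub_distrib]
  refine Finset.sum_congr rfl fun x hx => ?_
  simp only [covariance_const_mul_left, covariance_const_mul_right, hc]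
  rw [show a x * b x * p x = ∑ y ∈ s, if x = y then a x * b y * p x else 0 by
    rw [Finset.sum_ite_eq, if_pos hx], ← Finset.sum_sub_distrib]
  refine Finset.sum_congr rfl fun y _ => ?_
  split_ifs <;> ring

theorem integral_linear_eq_zero {V : ℕ → Ω → ℝ} (hV : ∀ x, Integrable (V x) P)
    (h0 : ∀ x, ∫ ω, V x ω ∂P = 0) (s : Finset ℕ) (a : ℕ → ℝ) :
    ∫ ω, ∑ x ∈ s, a x * V x ω ∂P = 0 := by
  rw [integral_finsetSum _ fun x _ => (hV x).const_mul (a x)]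
  exact Finset.sum_eq_zero fun x _ => by rw [integral_const_mul, h0, mul_zero]

end Linear

/-! ### The quadratic form in orthonormal coordinates. -/

section QuadForm

/-- The quadratic form `∑ y_x² / p_x`. -/
noncomputable def quadForm (κ : ℕ) (p y : ℕ → ℝ) : ℝ :=
  ∑ x ∈ Finset.range (κ + 1), y x ^ 2 / p x

variable {p : ℕ → ℝ} {κ : ℕ}

theorem quadForm_nonneg (hp0 : ∀ x, 0 ≤ p x) (y : ℕ → ℝ) : 0 ≤ quadForm κ p y :=
  Finset.sum_nonneg fun x _ => div_nonneg (sq_nonneg _) (hp0 x)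

theorem quadForm_congr {y y' : ℕ → ℝ} (h : ∀ x ≤ κ, y x = y' x) :
    quadForm κ p y = quadForm κ p y' :=
  Finset.sum_congr rfl fun x hx => by rw [h x (Nat.le_of_lt_succ (Finset.mem_range.1 hx))]

theorem continuous_quadForm : Continuous (quadForm κ p) := by
  unfold quadForm
  fun_prop

theorem continuous_quadForm_blockGren (hp : Antitone p) (hκ : IsGreatest {x | 0 < p x} κ) :
    Continuous fun y => quadForm κ p (blockGren p y) :=
  continuous_finsetSum _ fun _ hx =>
    ((continuous_blockGren hp hκ (Nat.le_of_lt_succ (Finset.mem_range.1 hx))).pow 2).div_const _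

theorem quadForm_blockGren_le (hp : Antitone p) (hκ : IsGreatest {x | 0 < p x} κ) (y : ℕ → ℝ) :
    quadForm κ p (blockGren p y) ≤ quadForm κ p y :=
  (isProj_blockGren hp hκ y).weighted_norm_le hp hκ.1

theorem quadForm_le (hp : Antitone p) (hκ : IsGreatest {x | 0 < p x} κ) (y : ℕ → ℝ) :
    quadForm κ p y ≤ (p κ)⁻¹ * ∑ x ∈ Finset.range (κ + 1), y x ^ 2 := by
  rw [Finset.mul_sum]
  refine Finset.sum_le_sum fun x hx => ?_
  rw [div_eq_mul_inv, mul_comm]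
  exact mul_le_mul_of_nonneg_right
    (inv_anti₀ hκ.1 (hp (Nat.le_of_lt_succ (Finset.mem_range.1 hx)))) (sq_nonneg _)

theorem sum_range_eq_one (hp0 : ∀ x, 0 ≤ p x) (hp1 : HasSum p 1)
    (hκ : IsGreatest {x | 0 < p x} κ) : ∑ x ∈ Finset.range (κ + 1), p x = 1 :=
  (hasSum_sum_of_ne_finset_zero fun x hx => eq_zero_of_lt hp0 hκ (by simpa using hx)).unique hp1

/-- An orthonormal basis of the orthogonal complement of `√p`. -/
theorem exists_orthonormal_weights (hp : Antitone p)
    (hp0 : ∀ x, 0 ≤ p x) (hp1 : HasSum p 1) (hκ : IsGreatest {x | 0 < p x} κ) :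
    ∃ (c : Fin κ → EuclideanSpace ℝ (Fin (κ + 1))) (a : Fin κ → ℕ → ℝ),
      (∀ i j, ∑ x ∈ Finset.range (κ + 1), a i x * a j x * p x = if i = j then 1 else 0) ∧
      (∀ i, ∑ x ∈ Finset.range (κ + 1), a i x * p x = 0) ∧
      (∀ y : ℕ → ℝ, ∑ x ∈ Finset.range (κ + 1), y x = 0 → ∀ x ≤ κ,
        y x = √(p x) * ofVec κ (∑ i, (∑ x ∈ Finset.range (κ + 1), a i x * y x) • c i) x) ∧
      (∀ y : ℕ → ℝ, ∑ x ∈ Finset.range (κ + 1), y x = 0 →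
        quadForm κ p y = ∑ i, (∑ x ∈ Finset.range (κ + 1), a i x * y x) ^ 2) := by
  have hpos : ∀ x ≤ κ, 0 < √(p x) := fun x hx => Real.sqrt_pos.2 (pos_of_le hp hκ hx)
  have hsum := sum_range_eq_one hp0 hp1 hκ
  obtain ⟨u, hu⟩ : ∃ u, u = toVec κ fun x => √(p x) := ⟨_, rfl⟩
  have hunorm : ‖u‖ = 1 := by
    rw [EuclideanSpace.norm_eq, Real.sqrt_eq_one, ← hsum, Finset.sum_range]
    refine Finset.sum_congr rfl fun i _ => ?_
    rw [hu, toVec, Real.norm_eq_abs, sq_abs, Real.sq_sqrt (hp0 i)]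
  have hort : Orthonormal ℝ (({0} : Set (Fin (κ + 1))).domRestrict fun _ => u) :=
    ⟨fun _ => hunorm, fun i j hij => absurd (Subsingleton.elim i j) hij⟩
  -- The unit vector `√p` is completed to an orthonormal basis with `b 0 = √p`.
  obtain ⟨b, hb⟩ := hort.exists_orthonormalBasis_extension_of_card_eq (by simp)
  have hb0 : b 0 = u := hb 0 rfl
  have hbb : ∀ i j, inner ℝ (b i) (b j) = if i = j then (1 : ℝ) else 0 :=
    orthonormal_iff_ite.1 b.orthonormal
  -- Dividing by `√p` turns `quadForm` into a squared norm and `∑ y_x` into the coordinate along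
  -- `√p`.
  let vec : (ℕ → ℝ) → EuclideanSpace ℝ (Fin (κ + 1)) := fun y => toVec κ fun x => y x / √(p x)
  let a : Fin (κ + 1) → ℕ → ℝ := fun i x => ofVec κ (b i) x / √(p x)
  have hinner : ∀ i y, inner ℝ (b i) (vec y) = ∑ x ∈ Finset.range (κ + 1), a i x * y x := by
    intro i y
    rw [real_inner_comm, inner_toVec]
    exact Finset.sum_congr rfl fun x _ => by simp only [a]; ring
  have ha0 : ∀ x ≤ κ, a 0 x = 1 := fun x hx => by
    simp only [a, hb0, hu]
    rw [ofVec_toVec _ _ hx, div_self (hpos x hx).ne']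
  have hinner0 : ∀ y, inner ℝ (b 0) (vec y) = ∑ x ∈ Finset.range (κ + 1), y x := by
    intro y
    rw [hinner]
    exact Finset.sum_congr rfl fun x hx => by
      rw [ha0 x (Nat.le_of_lt_succ (Finset.mem_range.1 hx)), one_mul]
  have hmul : ∀ i j, ∑ x ∈ Finset.range (κ + 1), a i x * a j x * p x = inner ℝ (b i) (b j) := by
    intro i j
    rw [PiLp.inner_apply, Finset.sum_range]
    refine Finset.sum_congr rfl fun l _ => ?_
    have hl := hpos l (Nat.le_of_lt_succ l.2)
    have hl2 := Real.sq_sqrt (hp0 l)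
    simp only [a, ofVec_coe, RCLike.inner_apply, conj_trivial]
    generalize √(p l) = r at hl hl2
    rw [← hl2]
    field_simp
  have ha : ∀ i, ∑ x ∈ Finset.range (κ + 1), a i x * p x = inner ℝ (b i) (b 0) := by
    intro i
    rw [← hmul]
    exact Finset.sum_congr rfl fun x hx => by
      rw [ha0 x (Nat.le_of_lt_succ (Finset.mem_range.1 hx)), mul_one]
  refine ⟨fun i => b i.succ, fun i => a i.succ, fun i j => ?_, fun i => ?_, fun y hy x hx => ?_,
    fun y hy => ?_⟩
  · rw [hmul, hbb]
    simp only [Fin.succ_inj]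
  · rw [ha, hbb, if_neg (Fin.succ_ne_zero i)]
  · have h1 := b.sum_repr' (vec y)
    rw [Fin.sum_univ_succ, hinner0, hy, zero_smul, zero_add] at h1
    simp only [hinner] at h1
    rw [h1, ofVec_toVec _ _ hx, mul_div_cancel₀ _ (hpos x hx).ne']
  · have h1 := b.sum_sq_norm_inner_right (vec y)
    rw [Fin.sum_univ_succ, hinner0, hy, norm_zero, zero_pow two_ne_zero, zero_add,
      EuclideanSpace.norm_sq_eq] at h1
    simp only [hinner, Real.norm_eq_abs, sq_abs] at h1
    rw [h1, quadForm, Finset.sum_range]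
    refine Finset.sum_congr rfl fun i _ => ?_
    simp only [vec, toVec, div_pow, Real.sq_sqrt (hp0 i)]

end QuadForm

/-! ### Law of the limit process and strict ordering. -/

section LimitProcess

variable {Ω : Type*} [MeasurableSpace Ω] {P : Measure Ω}
  {p : ℕ → ℝ} {κ : ℕ} {Y : ℕ → Ω → ℝ}

theorem IsLimitProcess.memLp (hY : IsLimitProcess p Y P) (x : ℕ) : MemLp (Y x) 2 P :=
  (hY.gaussian.hasGaussianLaw_eval x).memLp_two

theorem IsLimitProcess.hasGaussianLaw_linear (hY : IsLimitProcess p Y P) {ι : Type*} [Finite ι]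
    (a : ι → ℕ → ℝ) (s : Finset ℕ) :
    HasGaussianLaw (fun ω (i : ι) => ∑ x ∈ s, a i x * Y x ω) P := by
  have := Fintype.ofFinite ι
  have h := (hY.gaussian.hasGaussianLaw s).map
    (ContinuousLinearMap.pi fun i : ι => ∑ x : s, a i x • ContinuousLinearMap.proj (R := ℝ) (φ := fun _ : s => ℝ) x)
  refine h.congr (Eventually.of_forall fun ω => funext fun i => ?_)
  simp [← Finset.sum_coe_sort s fun x => a i x * Y x ω]

theorem IsLimitProcess.hasLaw_linear [IsProbabilityMeasure P] (hY : IsLimitProcess p Y P) (a : ℕ → ℝ) (s : Finset ℕ) :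
    HasLaw (fun ω => ∑ x ∈ s, a x * Y x ω)
      (gaussianReal 0 (∑ x ∈ s, a x * a x * p x - (∑ x ∈ s, a x * p x) * ∑ x ∈ s, a x * p x).toNNReal)
      P := by
  have h := (hY.hasGaussianLaw_linear (fun _ : Unit => a) s).eval ()
  refine ⟨h.aemeasurable, ?_⟩
  rw [h.map_eq_gaussianReal, integral_linear_eq_zero (fun x => (hY.memLp x).integrable one_le_two)
    hY.mean, ← covariance_self h.aemeasurable, covariance_linear hY.memLp hY.covariance]

theorem IsLimitProcess.integral_sq (hY : IsLimitProcess p Y P) (x : ℕ) :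
    ∫ ω, Y x ω ^ 2 ∂P = p x - p x * p x := by
  have h1 := variance_of_integral_eq_zero (hY.memLp x).aemeasurable (hY.mean x)
  rw [← h1, ← covariance_self (hY.memLp x).aemeasurable, hY.covariance, if_pos rfl]

theorem IsLimitProcess.integrable_quadForm (hY : IsLimitProcess p Y P) :
    Integrable (fun ω => quadForm κ p fun x => Y x ω) P :=
  integrable_finsetSum _ fun x _ => (hY.memLp x).integrable_sq.div_const _

/-- Each term has mean `p_x (1 - p_x) / p_x = 1 - p_x`; these sum to `(κ + 1) - 1`. -/
theorem IsLimitProcess.integral_quadForm (hY : IsLimitProcess p Y P) (hp : Antitone p)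
    (hp0 : ∀ x, 0 ≤ p x) (hp1 : HasSum p 1) (hκ : IsGreatest {x | 0 < p x} κ) :
    ∫ ω, quadForm κ p (fun x => Y x ω) ∂P = κ := by
  unfold quadForm
  rw [integral_finsetSum _ fun x _ => (hY.memLp x).integrable_sq.div_const _]
  have h : ∀ x ∈ Finset.range (κ + 1), ∫ ω, Y x ω ^ 2 / p x ∂P = 1 - p x := fun x hx => by
    have := pos_of_le hp hκ (Nat.le_of_lt_succ (Finset.mem_range.1 hx))
    rw [integral_div, hY.integral_sq]
    field_simp
  rw [Finset.sum_congr rfl h, Finset.sum_sub_distrib, sum_range_eq_one hp0 hp1 hκ]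
  simp

theorem IsLimitProcess.aestronglyMeasurable_comp {f : (ℕ → ℝ) → ℝ} (hf : Continuous f)
    (hY : IsLimitProcess p Y P) :
    AEStronglyMeasurable (fun ω => f fun x => Y x ω) P :=
  (hf.measurable.comp_aemeasurable
    (aemeasurable_pi_lambda _ fun x => (hY.memLp x).aemeasurable)).aestronglyMeasurable

theorem IsLimitProcess.integrable_quadForm_blockGren (hY : IsLimitProcess p Y P)
    (hp : Antitone p) (hp0 : ∀ x, 0 ≤ p x) (hκ : IsGreatest {x | 0 < p x} κ) :
    Integrable (fun ω => quadForm κ p (blockGren p fun x => Y x ω)) P :=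
  hY.integrable_quadForm.mono' (IsLimitProcess.aestronglyMeasurable_comp
    (f := fun y => quadForm κ p (blockGren p y)) (continuous_quadForm_blockGren hp hκ) hY)
    (ae_of_all _ fun ω => by
      rw [Real.norm_eq_abs, abs_of_nonneg (quadForm_nonneg hp0 _)]
      exact quadForm_blockGren_le hp hκ _)

/-- The limit process is the image of a standard normal vector under an isometry onto the
orthogonal complement of `√p`, up to the weights `√p`. -/
theorem IsLimitProcess.exists_standardization [IsProbabilityMeasure P] (hY : IsLimitProcess p Y P) (hp : Antitone p)
    (hp0 : ∀ x, 0 ≤ p x) (hp1 : HasSum p 1) (hκ : IsGreatest {x | 0 < p x} κ) :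
    ∃ (c : Fin κ → EuclideanSpace ℝ (Fin (κ + 1))) (ζ : Fin κ → Ω → ℝ),
      HasLaw (fun ω i => ζ i ω) (Measure.pi fun _ : Fin κ => gaussianReal 0 1) P ∧
      (∀ᵐ ω ∂P, ∀ x ≤ κ, Y x ω = √(p x) * ofVec κ (∑ i, ζ i ω • c i) x) ∧
      (∀ᵐ ω ∂P, quadForm κ p (fun x => Y x ω) = ∑ i, ζ i ω ^ 2) ∧
      ∀ y : ℕ → ℝ, ∑ x ∈ Finset.range (κ + 1), y x = 0 → ∃ z : Fin κ → ℝ,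
        ∀ x ≤ κ, y x = √(p x) * ofVec κ (∑ i, z i • c i) x := by
  obtain ⟨c, a, haa, ha, hrep, hquad⟩ := exists_orthonormal_weights hp hp0 hp1 hκ
  have hsum := sum_range_eq_one hp0 hp1 hκ
  let ξ : (ℕ → ℝ) → Ω → ℝ := fun a ω => ∑ x ∈ Finset.range (κ + 1), a x * Y x ω
  have hcov : ∀ a b : ℕ → ℝ, cov[ξ a, ξ b; P] = ∑ x ∈ Finset.range (κ + 1), a x * b x * p x -
      (∑ x ∈ Finset.range (κ + 1), a x * p x) * ∑ x ∈ Finset.range (κ + 1), b x * p x :=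
    fun a b => covariance_linear hY.memLp hY.covariance _ a b
  have hξ : HasGaussianLaw (fun ω (i : Fin κ) => ξ (a i) ω) P := hY.hasGaussianLaw_linear a _
  have hmem : ∀ a, MemLp (ξ a) 2 P := fun a => memLp_linear hY.memLp _ a
  -- The total `∑ Y_x` is centred with variance `1 - 1 = 0`.
  have hξ0 : ∀ᵐ ω ∂P, ∑ x ∈ Finset.range (κ + 1), Y x ω = 0 := by
    have h1 := ae_eq_integral_of_variance_eq_zero (hmem fun _ => 1) (by
      rw [← covariance_self (hmem fun _ => 1).aemeasurable, hcov]
      simp only [one_mul, hsum, sub_self])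
    filter_upwards [h1] with ω hω
    have h2 : ξ (fun _ => 1) ω = 0 := hω.trans
      (integral_linear_eq_zero (fun x => (hY.memLp x).integrable one_le_two) hY.mean _ _)
    simpa only [ξ, one_mul] using h2
  refine ⟨c, fun i => ξ (a i), ⟨hξ.aemeasurable, ?_⟩, ?_, ?_, fun y hy => ⟨_, hrep y hy⟩⟩
  -- Jointly Gaussian and uncorrelated coordinates are independent.
  · have hind : iIndepFun (fun i : Fin κ => ξ (a i)) P :=
      hξ.iIndepFun_of_covariance_eq_zero fun i j hij => by
        rw [hcov, haa, ha, if_neg hij, zero_mul, sub_zero]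
    rw [hind.map_fun_eq_pi_map fun i => (hmem (a i)).aemeasurable]
    congr 1
    ext1 i
    rw [(hY.hasLaw_linear (a i) _).map_eq, haa, ha, if_pos rfl, zero_mul, sub_zero, Real.toNNReal_one]
  · filter_upwards [hξ0] with ω hω
    exact hrep _ hω
  · filter_upwards [hξ0] with ω hω
    exact hquad _ hω

theorem IsLimitProcess.hasLaw_chiSquared [IsProbabilityMeasure P] (hY : IsLimitProcess p Y P) (hp : Antitone p)
    (hp0 : ∀ x, 0 ≤ p x) (hp1 : HasSum p 1) (hκ : IsGreatest {x | 0 < p x} κ) :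
    HasLaw (fun ω => quadForm κ p fun x => Y x ω) (chiSquared κ) P := by
  obtain ⟨c, ζ, hζ, -, hq, -⟩ := hY.exists_standardization hp hp0 hp1 hκ
  have hm : Measurable fun z : Fin κ → ℝ => ∑ i, z i ^ 2 := by fun_prop
  have h : HasLaw (fun z : Fin κ → ℝ => ∑ i, z i ^ 2) (chiSquared κ)
      (Measure.pi fun _ : Fin κ => gaussianReal 0 1) := ⟨hm.aemeasurable, rfl⟩
  exact (h.fun_comp hζ).congr hq

instance isOpenPosMeasure_gaussianReal : (gaussianReal 0 1).IsOpenPosMeasure :=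
  (gaussianReal_absolutelyContinuous' 0 one_ne_zero).isOpenPosMeasure

/-- If `p` is not strictly monotone, the projected quadratic form is strictly smaller with positive
probability, at every level. -/
theorem IsLimitProcess.measure_lt_pos [IsProbabilityMeasure P] (hY : IsLimitProcess p Y P) (hp : Antitone p)
    (hp0 : ∀ x, 0 ≤ p x) (hp1 : HasSum p 1) (hκ : IsGreatest {x | 0 < p x} κ)
    (hs : ¬ StrictAntiOn p (Set.Iic κ)) {t : ℝ} (ht : 0 < t) :
    0 < P {ω | quadForm κ p (blockGren p fun x => Y x ω) < t ∧
      t < quadForm κ p fun x => Y x ω} := by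
  obtain ⟨c, ζ, hζ, hYζ, -, hsurj⟩ := hY.exists_standardization hp hp0 hp1 hκ
  let L : (Fin κ → ℝ) → ℕ → ℝ := fun z x => √(p x) * ofVec κ (∑ i, z i • c i) x
  have hL : Continuous L := continuous_pi fun x => continuous_const.mul
    ((continuous_apply x).comp ((continuous_ofVec κ).comp (by fun_prop)))
  -- In the normal coordinates the event is almost surely the preimage of an open set, so one point
  -- of `U` suffices.
  let U : Set (Fin κ → ℝ) :=
    {z | quadForm κ p (blockGren p (L z)) < t ∧ t < quadForm κ p (L z)}
  have hU : IsOpen U := by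
    refine IsOpen.inter (isOpen_lt ((continuous_quadForm_blockGren hp hκ).comp hL) continuous_const)
      (isOpen_lt continuous_const (continuous_quadForm.comp hL))
  have hne : U.Nonempty := by
    obtain ⟨x, y, hxy, hy, hpe⟩ := exists_eq_of_not_strictAntiOn hp hs
    have hpx := pos_of_le hp hκ (hxy.le.trans hy)
    -- With this `r`, the vector `w` is projected to zero, while its two nonzero entries contribute
    -- `t` each to the quadratic form, hence `2 t > t`.
    set r := √(t * p x) with hr
    set w : ℕ → ℝ := Pi.single y r - Pi.single x r with hw
    have hw0 : ∑ z ∈ Finset.range (κ + 1), w z = 0 := by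
      simp only [hw, Pi.sub_apply, Finset.sum_sub_distrib, Pi.single_apply, Finset.sum_ite_eq',
        Finset.mem_range]
      rw [if_pos (by omega), if_pos (by omega), sub_self]
    obtain ⟨z, hz⟩ := hsurj w hw0
    have hzL : ∀ x ≤ κ, L z x = w x := fun x hx => (hz x hx).symm
    refine ⟨z, ?_, ?_⟩
    · rw [quadForm_congr fun x hx => (blockGren_congr hp hκ hzL hx).trans
        (blockGren_single_sub_single hp hκ (Real.sqrt_nonneg _) hxy hy hpe hx)]
      simpa [quadForm] using ht
    · rw [quadForm_congr hzL]
      have h1 : ∑ z ∈ ({x, y} : Finset ℕ), w z ^ 2 / p z ≤ quadForm κ p w :=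
        Finset.sum_le_sum_of_subset_of_nonneg
          (fun z hz => by
            simp only [Finset.mem_insert, Finset.mem_singleton] at hz
            rw [Finset.mem_range]
            omega)
          fun z _ _ => div_nonneg (sq_nonneg _) (hp0 z)
      rw [Finset.sum_pair hxy.ne, ← hpe] at h1
      have hwx : w x ^ 2 = t * p x := by
        simp [hw, hxy.ne, hr, Real.sq_sqrt (mul_pos ht hpx).le]
      have hwy : w y ^ 2 = t * p x := by
        simp [hw, hxy.ne', hr, Real.sq_sqrt (mul_pos ht hpx).le]
      rw [hwx, hwy, mul_div_cancel_right₀ _ hpx.ne'] at h1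
      linarith
  have hpos := hU.measure_pos (Measure.pi fun _ : Fin κ => gaussianReal 0 1) hne
  rw [← hζ.map_eq, Measure.map_apply_of_aemeasurable hζ.aemeasurable hU.measurableSet] at hpos
  refine hpos.trans_le (measure_mono_ae ?_)
  filter_upwards [hYζ] with ω hω hmem
  have hωL : ∀ x ≤ κ, (fun x => Y x ω) x = L (fun i => ζ i ω) x := hω
  have hmem' : (fun i => ζ i ω) ∈ U := hmem
  refine ⟨?_, ?_⟩
  · rw [quadForm_congr fun x hx => blockGren_congr hp hκ hωL hx]
    exact hmem'.1
  · rw [quadForm_congr hωL]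
    exact hmem'.2

end LimitProcess

/-! ### Central limit theorem for the empirical process. -/

section CentralLimit

variable {Ω Ω' : Type*} [MeasurableSpace Ω] [MeasurableSpace Ω']
  {P : Measure Ω} [IsProbabilityMeasure P] {P' : Measure Ω'} [IsProbabilityMeasure P']
  {p : ℕ → ℝ} {X : ℕ → Ω → ℕ} {Y : ℕ → Ω' → ℝ}

theorem identDistrib_of_law (hX : ∀ i, Measurable (X i))
    (hlaw : ∀ i x, P.real {ω | X i ω = x} = p x) (i j : ℕ) : IdentDistrib (X i) (X j) P P := by
  refine ⟨(hX i).aemeasurable, (hX j).aemeasurable, Measure.ext_of_singleton fun x => ?_⟩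
  rw [Measure.map_apply (hX i) (measurableSet_singleton x),
    Measure.map_apply (hX j) (measurableSet_singleton x), ← measureReal_eq_measureReal_iff]
  exact (hlaw i x).trans (hlaw j x).symm

/-- A linear form of the process is a normalised sum of the i.i.d. variables `φ (X i)`, whose
variance agrees with that of the form in `Y` since both share the multinomial covariance. -/
theorem tendstoInDistribution_linear (hX : ∀ i, Measurable (X i)) (hind : iIndepFun X P)
    (hlaw : ∀ i x, P.real {ω | X i ω = x} = p x) (hY : IsLimitProcess p Y P') (s : Finset ℕ)
    (a : ℕ → ℝ) :
    TendstoInDistribution (fun n ω => ∑ x ∈ s, a x * empiricalProcess p X n ω x) atTop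
      (fun ω => ∑ x ∈ s, a x * Y x ω) (fun _ => P) P' := by
  let φ : ℕ → ℝ := fun m => ∑ x ∈ s, a x * if m = x then (1 : ℝ) else 0
  have hφ : Measurable φ := measurable_of_countable _
  have hmem : MemLp (fun ω => φ (X 0 ω)) 2 P := memLp_linear (fun x => memLp_indicator hX 0 x) s a
  have hvar : Var[fun ω => φ (X 0 ω); P] =
      ∑ x ∈ s, a x * a x * p x - (∑ x ∈ s, a x * p x) * ∑ x ∈ s, a x * p x := by
    rw [← covariance_self hmem.aemeasurable]
    exact covariance_linear (fun x => memLp_indicator hX 0 x)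
      (fun x y => covariance_indicator hX hlaw 0 x y) s a a
  have hmean : ∫ ω, φ (X 0 ω) ∂P = ∑ x ∈ s, a x * p x := by
    simp only [φ]
    rw [integral_finsetSum _ fun x _ =>
      ((memLp_indicator hX 0 x).integrable one_le_two).const_mul (a x)]
    exact Finset.sum_congr rfl fun x _ => by rw [integral_const_mul, integral_indicator_eq hX hlaw]
  have hYlaw := hY.hasLaw_linear a s
  rw [← hvar] at hYlaw
  have h := tendstoInDistribution_inv_sqrt_mul_sum_sub (X := fun i ω => φ (X i ω)) hYlaw hmem
    (hind.comp (fun _ => φ) fun _ => hφ) fun i => (identDistrib_of_law hX hlaw i 0).comp hφ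
  convert h using 3 with n ω
  rw [hmean]
  simp only [empiricalProcess_eq, φ]
  rw [Finset.sum_comm]
  simp only [Finset.mul_sum, ← Finset.sum_sub_distrib]
  refine Finset.sum_congr rfl fun x _ => ?_
  simp only [← Finset.mul_sum]
  rw [Finset.sum_sub_distrib, Finset.sum_const, Finset.card_range, nsmul_eq_mul]
  ring

/-- The central limit theorem for the empirical process. -/
theorem tendstoInDistribution_empiricalProcess (hX : ∀ i, Measurable (X i)) (hind : iIndepFun X P)
    (hlaw : ∀ i x, P.real {ω | X i ω = x} = p x) (hY : IsLimitProcess p Y P') (κ : ℕ) :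
    TendstoInDistribution (fun n ω => toVec κ (empiricalProcess p X n ω)) atTop
      (fun ω => toVec κ fun x => Y x ω) (fun _ => P) P' := by
  refine tendstoInDistribution_of_forall_inner
    (fun n => aemeasurable_toVec fun x => (measurable_empiricalProcess hX n x).aemeasurable)
    (aemeasurable_toVec fun x => (hY.memLp x).aemeasurable) fun t => ?_
  simp only [inner_toVec]
  exact tendstoInDistribution_linear hX hind hlaw hY _ _

theorem tendstoInDistribution_comp_empiricalProcess (hX : ∀ i, Measurable (X i))
    (hind : iIndepFun X P) (hlaw : ∀ i x, P.real {ω | X i ω = x} = p x)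
    (hY : IsLimitProcess p Y P') {κ : ℕ} {f : (ℕ → ℝ) → ℝ} (hf : Continuous f)
    (hfκ : ∀ y y' : ℕ → ℝ, (∀ x ≤ κ, y x = y' x) → f y = f y') :
    TendstoInDistribution (fun n ω => f (empiricalProcess p X n ω)) atTop
      (fun ω => f fun x => Y x ω) (fun _ => P) P' := by
  have h := (tendstoInDistribution_empiricalProcess hX hind hlaw hY κ).continuous_comp
    (hf.comp (continuous_ofVec κ))
  have hfv : ∀ y, f (ofVec κ (toVec κ y)) = f y := fun y =>
    hfκ _ _ fun x hx => ofVec_toVec κ y hx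
  simpa only [Function.comp_def, hfv] using h

end CentralLimit

/-! ### Sample properties: support, measurability, integrability. -/

section Sample

variable {Ω : Type*} [MeasurableSpace Ω] {P : Measure Ω} {p : ℕ → ℝ} {κ : ℕ} {X : ℕ → Ω → ℕ}

theorem isFreq_empirical {Ω : Type*} {X : ℕ → Ω → ℕ} {ω : Ω} (h : ∀ i, X i ω ≤ κ) (n : ℕ) :
    IsFreq κ (sampleMax X n ω) (empirical X n ω) where
  nonneg x := mul_nonneg (by positivity) (Finset.sum_nonneg fun i _ => by split_ifs <;> norm_num)
  eq_zero x hx := by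
    rw [empirical, Finset.sum_eq_zero fun i _ => if_neg ?_, mul_zero]
    have := h i
    omega
  sum_le k := by
    simp only [empirical]
    rw [← Finset.mul_sum, Finset.sum_comm]
    have h1 : ∑ i ∈ Finset.range n, ∑ x ∈ Finset.range k, (if X i ω = x then (1 : ℝ) else 0) ≤
        ∑ i ∈ Finset.range n, (1 : ℝ) := Finset.sum_le_sum fun i _ => by
      rw [Finset.sum_ite_eq]
      split_ifs <;> norm_num
    rw [Finset.sum_const, Finset.card_range, nsmul_eq_mul, mul_one] at h1
    exact (mul_le_mul_of_nonneg_left h1 (by positivity)).trans inv_mul_le_one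
  le := Finset.sup_le fun i _ => h i
  eq_of_pos he := by
    refine le_antisymm (Finset.sup_le fun i _ => h i) ?_
    have h1 : ∑ i ∈ Finset.range n, (if X i ω = κ then (1 : ℝ) else 0) ≠ 0 := fun h0 => by
      rw [empirical, h0, mul_zero] at he
      exact lt_irrefl _ he
    obtain ⟨i, hi, hne⟩ := Finset.exists_ne_zero_of_sum_ne_zero h1
    have hiκ : X i ω = κ := by
      by_contra h2
      exact hne (if_neg h2)
    rw [← hiκ]
    exact Finset.le_sup (f := fun i => X i ω) hi

theorem ae_le_of_law [IsFiniteMeasure P] (hp0 : ∀ x, 0 ≤ p x) (hκ : IsGreatest {x | 0 < p x} κ)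
    (hlaw : ∀ i x, P.real {ω | X i ω = x} = p x) : ∀ᵐ ω ∂P, ∀ i, X i ω ≤ κ := by
  have h : ∀ᵐ ω ∂P, ∀ i x, κ < x → X i ω ≠ x := by
    refine ae_all_iff.2 fun i => ae_all_iff.2 fun x => ?_
    by_cases hx : κ < x
    · have h1 := hlaw i x
      rw [eq_zero_of_lt hp0 hκ hx, measureReal_eq_zero_iff] at h1
      simpa [ae_iff, hx] using h1
    · simp [hx]
  filter_upwards [h] with ω hω i
  by_contra! hlt
  exact hω i _ hlt rfl

/-- Every function of the estimator is measurable, as a function of finitely many discrete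
variables. -/
theorem measurable_of_empirical (hX : ∀ i, Measurable (X i)) (n : ℕ)
    (Φ : ℕ → (ℕ → ℝ) → ℝ) : Measurable fun ω => Φ (sampleMax X n ω) (empirical X n ω) := by
  let X' : ℕ → (Fin n → ℕ) → ℕ := fun i v => if h : i < n then v ⟨i, h⟩ else 0
  have hX' : ∀ ω, ∀ i ∈ Finset.range n, X' i (fun j => X j ω) = X i ω := fun ω i hi => by
    simp only [X', Finset.mem_range.1 hi, dif_pos]
  have h1 : ∀ ω, sampleMax X n ω = sampleMax X' n fun j => X j ω := fun ω =>
    (Finset.sup_congr rfl fun i hi => hX' ω i hi).symm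
  have h2 : ∀ ω, empirical X n ω = empirical X' n fun j => X j ω := fun ω => by
    ext x
    simp only [empirical]
    rw [Finset.sum_congr rfl fun i hi => by rw [← hX' ω i hi]]
  simp only [h1, h2]
  exact (measurable_of_countable fun v => Φ (sampleMax X' n v) (empirical X' n v)).comp
    (measurable_pi_lambda _ fun j => hX j)

theorem integrable_hellingerSq [IsProbabilityMeasure P] (hX : ∀ i, Measurable (X i))
    (hp0 : ∀ x, 0 ≤ p x) (hp1 : ∀ x, p x ≤ 1)
    (hκ : IsGreatest {x | 0 < p x} κ) (hlaw : ∀ i x, P.real {ω | X i ω = x} = p x)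
    {Φ : ℕ → (ℕ → ℝ) → ℕ → ℝ} (hΦ0 : ∀ M e, IsFreq κ M e → ∀ x, κ < x → Φ M e x = 0)
    (hΦ1 : ∀ M e, IsFreq κ M e → ∀ x, Φ M e x ≤ 1) (n : ℕ) :
    Integrable (fun ω => n * hellingerSq (Φ (sampleMax X n ω) (empirical X n ω)) p) P := by
  refine Integrable.of_bound (measurable_of_empirical hX n
    fun M e => n * hellingerSq (Φ M e) p).aestronglyMeasurable (n * (κ + 1)) ?_
  filter_upwards [ae_le_of_law hp0 hκ hlaw] with ω hω
  have he := isFreq_empirical hω n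
  rw [Real.norm_eq_abs, abs_of_nonneg (mul_nonneg n.cast_nonneg (hellingerSq_nonneg _ _))]
  exact mul_le_mul_of_nonneg_left (hellingerSq_le hp0 hp1 hκ (hΦ0 _ _ he) (hΦ1 _ _ he))
    n.cast_nonneg

/-- Cauchy–Schwarz over the `κ + 1` coordinates reduces to the fourth moments. -/
theorem integral_sq_sum_sq_le [IsProbabilityMeasure P] (hX : ∀ i, Measurable (X i))
    (hind : iIndepFun X P) (hlaw : ∀ i x, P.real {ω | X i ω = x} = p x) (κ n : ℕ) :
    Integrable (fun ω => (∑ x ∈ Finset.range (κ + 1), empiricalProcess p X n ω x ^ 2) ^ 2) P ∧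
    ∫ ω, (∑ x ∈ Finset.range (κ + 1), empiricalProcess p X n ω x ^ 2) ^ 2 ∂P ≤
      (κ + 1) * ((κ + 1) * (48 * Real.exp 1)) := by
  have h4 := integral_empiricalProcess_pow_four_le hX hind hlaw n
  have hle : ∀ ω, (∑ x ∈ Finset.range (κ + 1), empiricalProcess p X n ω x ^ 2) ^ 2 ≤
      (κ + 1) * ∑ x ∈ Finset.range (κ + 1), empiricalProcess p X n ω x ^ 4 := fun ω => by
    have := sq_sum_le_card_mul_sum_sq (s := Finset.range (κ + 1))
      (f := fun x => empiricalProcess p X n ω x ^ 2)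
    simpa only [← pow_mul, Finset.card_range, Nat.cast_add, Nat.cast_one] using this
  have hI : Integrable (fun ω => (κ + 1 : ℝ) *
      ∑ x ∈ Finset.range (κ + 1), empiricalProcess p X n ω x ^ 4) P :=
    (integrable_finsetSum _ fun x _ => (h4 x).1).const_mul _
  have hJ : Integrable
      (fun ω => (∑ x ∈ Finset.range (κ + 1), empiricalProcess p X n ω x ^ 2) ^ 2) P :=
    hI.mono' ((Finset.measurable_fun_sum _ fun x _ =>
      (measurable_empiricalProcess hX n x).pow_const 2).pow_const 2).aestronglyMeasurable
      (ae_of_all _ fun ω => by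
        rw [Real.norm_eq_abs, abs_of_nonneg (sq_nonneg _)]
        exact hle ω)
  refine ⟨hJ, (integral_mono hJ hI hle).trans ?_⟩
  rw [integral_const_mul, integral_finsetSum _ fun x _ => (h4 x).1]
  refine mul_le_mul_of_nonneg_left ?_ (by positivity)
  refine (Finset.sum_le_sum fun x _ => (h4 x).2).trans_eq ?_
  simp

end Sample

/-! ### From the pathwise inequality to both modes of convergence. -/

section Limit

variable {Ω Ω' : Type*} [MeasurableSpace Ω] [MeasurableSpace Ω']
  {P : Measure Ω} [IsProbabilityMeasure P] {P' : Measure Ω'} [IsProbabilityMeasure P']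
  {p : ℕ → ℝ} {κ : ℕ} {X : ℕ → Ω → ℕ} {Y : ℕ → Ω' → ℝ}

/-- A sequence of statistics that is close to a continuous form of the empirical process, dominated
by `∑ y_x² / p_x`, converges in distribution and in mean. -/
theorem tendsto_of_abs_sub_le (hp : Antitone p) (hκ : IsGreatest {x | 0 < p x} κ)
    (hX : ∀ i, Measurable (X i)) (hind : iIndepFun X P)
    (hlaw : ∀ i x, P.real {ω | X i ω = x} = p x) (hY : IsLimitProcess p Y P')
    {f : (ℕ → ℝ) → ℝ} (hf : Continuous f)
    (hfκ : ∀ y y' : ℕ → ℝ, (∀ x ≤ κ, y x = y' x) → f y = f y') (hf0 : ∀ y, 0 ≤ f y)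
    (hfle : ∀ y, f y ≤ quadForm κ p y) (hfY : Integrable (fun ω => f fun x => Y x ω) P')
    {T : ℕ → Ω → ℝ} (hT : ∀ n, Integrable (T n) P) {C : ℝ}
    (hTf : ∀ n : ℕ, 1 ≤ n → ∀ᵐ ω ∂P, |T n ω - 1 / 8 * f (empiricalProcess p X n ω)| ≤
      C / √n * (κ + 1 + (∑ x ∈ Finset.range (κ + 1), empiricalProcess p X n ω x ^ 2) ^ 2)) :
    TendstoInDistribution T atTop (fun ω => 1 / 8 * f fun x => Y x ω) (fun _ => P) P' ∧
      Tendsto (fun n => ∫ ω, T n ω ∂P) atTop (𝓝 (∫ ω, 1 / 8 * f (fun x => Y x ω) ∂P')) := by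
  have hQ := integral_sq_sum_sq_le (p := p) hX hind hlaw κ
  set B : ℝ := (κ + 1) * ((κ + 1) * (48 * Real.exp 1)) with hB
  have hf8 : Continuous fun y => 1 / 8 * f y := continuous_const.mul hf
  have hconv := tendstoInDistribution_comp_empiricalProcess hX hind hlaw hY (κ := κ) hf8
    fun y y' h => by rw [hfκ y y' h]
  have hmeas : ∀ n, AEMeasurable (fun ω => 1 / 8 * f (empiricalProcess p X n ω)) P :=
    hconv.forall_aemeasurable
  have hsq : ∀ n ω, (1 / 8 * f (empiricalProcess p X n ω)) ^ 2 ≤ ((p κ)⁻¹) ^ 2 *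
      (∑ x ∈ Finset.range (κ + 1), empiricalProcess p X n ω x ^ 2) ^ 2 := fun n ω => by
    rw [← mul_pow]
    have h1 := (hfle (empiricalProcess p X n ω)).trans (quadForm_le hp hκ _)
    have h2 := hf0 (empiricalProcess p X n ω)
    exact pow_le_pow_left₀ (by linarith) (by linarith) 2
  have hI2 : ∀ n, Integrable (fun ω => (1 / 8 * f (empiricalProcess p X n ω)) ^ 2) P := fun n =>
    ((hQ n).1.const_mul (((p κ)⁻¹) ^ 2)).mono' ((hmeas n).pow_const 2).aestronglyMeasurable
      (ae_of_all _ fun ω => by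
        rw [Real.norm_eq_abs, abs_of_nonneg (sq_nonneg _)]
        exact hsq n ω)
  have hI : ∀ n, Integrable (fun ω => 1 / 8 * f (empiricalProcess p X n ω)) P := fun n =>
    ((memLp_two_iff_integrable_sq (hmeas n).aestronglyMeasurable).2 (hI2 n)).integrable one_le_two
  have hmean := tendsto_integral_of_tendstoInDistribution hconv
    (fun n ω => mul_nonneg (by norm_num) (hf0 _)) (fun ω => mul_nonneg (by norm_num) (hf0 _))
    (hfY.const_mul _) hI hI2 (C := ((p κ)⁻¹) ^ 2 * B) fun n => by
      refine (integral_mono (hI2 n) ((hQ n).1.const_mul _) (hsq n)).trans ?_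
      rw [integral_const_mul]
      exact mul_le_mul_of_nonneg_left (hQ n).2 (sq_nonneg _)
  -- Replacing `C` by `|C|` keeps the error bound nonnegative.
  have hR : ∀ n : ℕ, Integrable (fun ω => |C| / √n *
      (κ + 1 + (∑ x ∈ Finset.range (κ + 1), empiricalProcess p X n ω x ^ 2) ^ 2)) P := fun n =>
    ((integrable_const _).add (hQ n).1).const_mul _
  refine tendsto_of_integral_error hconv hI hT hR hmean ?_ ?_
  · filter_upwards [eventually_ge_atTop 1] with n hn
    filter_upwards [hTf n hn] with ω hω
    refine hω.trans (mul_le_mul_of_nonneg_right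
      (div_le_div_of_nonneg_right (le_abs_self C) (Real.sqrt_nonneg _)) (by positivity))
  · have h0 : Tendsto (fun n : ℕ => |C| / √n * (κ + 1 + B)) atTop (𝓝 0) := by
      have h1 : Tendsto (fun n : ℕ => |C| / √(n : ℝ)) atTop (𝓝 0) :=
        tendsto_const_nhds.div_atTop (Real.tendsto_sqrt_atTop.comp tendsto_natCast_atTop_atTop)
      simpa using h1.mul_const (κ + 1 + B)
    refine squeeze_zero (fun n => integral_nonneg fun ω => by positivity) (fun n => ?_) h0
    rw [integral_const_mul, integral_add (integrable_const _) (hQ n).1]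
    refine mul_le_mul_of_nonneg_left ?_ (by positivity)
    simpa using (hQ n).2

end Limit

end MonotonePMF

/-! ### The theorem. -/

theorem mainTheorem10
    {Ω Ω' : Type*} [MeasurableSpace Ω] [MeasurableSpace Ω']
    (P : Measure Ω) [IsProbabilityMeasure P] (P' : Measure Ω') [IsProbabilityMeasure P']
    -- a decreasing probability mass function with finite support `{0, …, κ}`
    (p : ℕ → ℝ) (hp_nonneg : ∀ x, 0 ≤ p x) (hp_sum : HasSum p 1) (hp_anti : Antitone p)
    (κ : ℕ) (hκ : IsGreatest {x | 0 < p x} κ)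
    -- independent observations with mass function `p`
    (X : ℕ → Ω → ℕ) (hX_meas : ∀ i, Measurable (X i)) (hX_indep : iIndepFun X P)
    (hX_law : ∀ i x, P.real {ω | X i ω = x} = p x)
    -- the limit process
    (Y : ℕ → Ω' → ℝ) (hY : IsLimitProcess p Y P') :
    let W : Ω' → ℝ := fun ω => ∑ x ∈ Finset.range (κ + 1), Y x ω ^ 2 / p x
    let WG : Ω' → ℝ := fun ω =>
      ∑ x ∈ Finset.range (κ + 1), blockGren p (fun z => Y z ω) x ^ 2 / p x
    let D : ℕ → Ω → ℝ := fun n ω => n * hellingerSq (empirical X n ω) p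
    let DR : ℕ → Ω → ℝ := fun n ω => n * hellingerSq (rearrangement X n ω) p
    let DG : ℕ → Ω → ℝ := fun n ω => n * hellingerSq (grenander X n ω) p
    -- convergence in distribution
    TendstoInDistribution D atTop (fun ω => 1 / 8 * W ω) (fun _ => P) P' ∧
    TendstoInDistribution DR atTop (fun ω => 1 / 8 * W ω) (fun _ => P) P' ∧
    TendstoInDistribution DG atTop (fun ω => 1 / 8 * WG ω) (fun _ => P) P' ∧
    -- stochastic ordering of the limits, strict if `p` is not strictly monotone
    (∀ t : ℝ, P' {ω | t < 1 / 8 * WG ω} ≤ P' {ω | t < 1 / 8 * W ω}) ∧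
    (¬ StrictAntiOn p (Set.Iic κ) →
      ∀ t : ℝ, 0 < t → P' {ω | t < 1 / 8 * WG ω} < P' {ω | t < 1 / 8 * W ω}) ∧
    -- the chi-squared law
    HasLaw W (chiSquared κ) P' ∧
    -- convergence in expectation
    (∀ n, Integrable (D n) P ∧ Integrable (DR n) P ∧ Integrable (DG n) P) ∧
    Integrable W P' ∧ Integrable WG P' ∧
    Tendsto (fun n => ∫ ω, D n ω ∂P) atTop (𝓝 (∫ ω, 1 / 8 * W ω ∂P')) ∧
    Tendsto (fun n => ∫ ω, DR n ω ∂P) atTop (𝓝 (∫ ω, 1 / 8 * W ω ∂P')) ∧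
    Tendsto (fun n => ∫ ω, DG n ω ∂P) atTop (𝓝 (∫ ω, 1 / 8 * WG ω ∂P')) ∧
    -- the means of the limits
    ∫ ω, WG ω ∂P' ≤ ∫ ω, W ω ∂P' ∧
    ∫ ω, W ω ∂P' = κ ∧
    (∫ ω, WG ω ∂P' = ∫ ω, W ω ∂P' ↔ StrictAntiOn p (Set.Iic κ)) := by
  intro W WG D DR DG
  have hp1 : ∀ x, p x ≤ 1 := fun x => le_hasSum hp_sum x fun y _ => hp_nonneg y
  have hle : ∀ ω, WG ω ≤ W ω := fun ω => quadForm_blockGren_le hp_anti hκ _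
  have hWint : Integrable W P' := hY.integrable_quadForm
  have hWGint : Integrable WG P' := hY.integrable_quadForm_blockGren hp_anti hp_nonneg hκ
  have hDint : ∀ n, Integrable (D n) P := integrable_hellingerSq hX_meas hp_nonneg hp1 hκ hX_law
    (Φ := fun _ e => e) (fun _ _ he => he.eq_zero) fun _ _ he => he.le_one
  have hDRint : ∀ n, Integrable (DR n) P := integrable_hellingerSq hX_meas hp_nonneg hp1 hκ hX_law
    (Φ := rear) (fun _ _ he _ hx => he.rear_eq_zero hx) fun _ _ he => he.rear_le_one
  have hDGint : ∀ n, Integrable (DG n) P := integrable_hellingerSq hX_meas hp_nonneg hp1 hκ hX_law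
    (Φ := gren) (fun _ _ he _ hx => he.gren_eq_zero hx) fun _ _ he => he.gren_le_one
  obtain ⟨C, -, hC⟩ := exists_abs_hellingerSq_sub_le hp_anti hp_nonneg hp1 hκ
  have hCn : ∀ n : ℕ, 1 ≤ n → ∀ᵐ ω ∂P, _ := fun n hn => by
    filter_upwards [ae_le_of_law hp_nonneg hκ hX_law] with ω hω
    -- The scale is `s = √n`, so that `s ^ 2 = n` and `z` is the empirical process.
    have h := hC (√n) _ _ (empiricalProcess p X n ω)
      (Real.one_le_sqrt.2 (by exact_mod_cast hn)) (isFreq_empirical hω n) fun x _ => rfl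
    rw [Real.sq_sqrt n.cast_nonneg] at h
    exact h
  have hfW := continuous_quadForm (p := p) (κ := κ)
  have hfWG := continuous_quadForm_blockGren hp_anti hκ
  have hD := tendsto_of_abs_sub_le hp_anti hκ hX_meas hX_indep hX_law hY hfW
    (fun _ _ => quadForm_congr) (quadForm_nonneg hp_nonneg) (fun _ => le_rfl) hWint hDint
    fun n hn => (hCn n hn).mono fun ω h => h.1
  have hDR := tendsto_of_abs_sub_le hp_anti hκ hX_meas hX_indep hX_law hY hfW
    (fun _ _ => quadForm_congr) (quadForm_nonneg hp_nonneg) (fun _ => le_rfl) hWint hDRint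
    fun n hn => (hCn n hn).mono fun ω h => h.2.1
  have hDG := tendsto_of_abs_sub_le hp_anti hκ hX_meas hX_indep hX_law hY hfWG
    (fun _ _ h => quadForm_congr fun _ => blockGren_congr hp_anti hκ h)
    (fun _ => quadForm_nonneg hp_nonneg _) (quadForm_blockGren_le hp_anti hκ) hWGint hDGint
    fun n hn => (hCn n hn).mono fun ω h => h.2.2
  have hmono : ∀ t : ℝ, {ω | t < 1 / 8 * WG ω} ⊆ {ω | t < 1 / 8 * W ω} := fun t ω (h : _ < _) =>
    h.trans_le (mul_le_mul_of_nonneg_left (hle ω) (by norm_num))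
  have hstrict : ¬ StrictAntiOn p (Set.Iic κ) → ∀ t : ℝ, 0 < t →
      P' {ω | t < 1 / 8 * WG ω} < P' {ω | t < 1 / 8 * W ω} := fun hs t ht => by
    have h1 := hY.measure_lt_pos hp_anti hp_nonneg hp_sum hκ hs (t := 8 * t) (by linarith)
    have hnull : NullMeasurableSet {ω | t < 1 / 8 * WG ω} P' :=
      nullMeasurableSet_lt aemeasurable_const (hWGint.const_mul _).aemeasurable
    -- The larger event exceeds the smaller one by `W^G ≤ 8 t < W`, which contains an event of
    -- positive probability.
    have h4 := measure_inter_add_sdiff₀ {ω | t < 1 / 8 * W ω} hnull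
    rw [Set.inter_eq_self_of_subset_right (hmono t)] at h4
    rw [← h4]
    refine ENNReal.lt_add_right (measure_ne_top _ _) (h1.trans_le (measure_mono ?_)).ne'
    rintro ω ⟨h2, h3⟩
    have h2' : WG ω < 8 * t := h2
    have h3' : 8 * t < W ω := h3
    refine ⟨?_, ?_⟩
    · change t < 1 / 8 * W ω
      linarith
    · change ¬ t < 1 / 8 * WG ω
      linarith
  refine ⟨hD.1, hDR.1, hDG.1, fun t => measure_mono (hmono t), hstrict,
    hY.hasLaw_chiSquared hp_anti hp_nonneg hp_sum hκ, fun n => ⟨hDint n, hDRint n, hDGint n⟩,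
    hWint, hWGint, hD.2, hDR.2, hDG.2, integral_mono hWGint hWint hle,
    hY.integral_quadForm hp_anti hp_nonneg hp_sum hκ, fun heq => ?_, fun hs => ?_⟩
  -- Since `W^G ≤ W`, equal means force almost sure equality, against the strict ordering at level
  -- `1`.
  · by_contra hs
    have h0 : ∫ ω, (W ω - WG ω) ∂P' = 0 := by rw [integral_sub hWint hWGint, heq, sub_self]
    rw [integral_eq_zero_iff_of_nonneg (fun ω => sub_nonneg.2 (hle ω)) (hWint.sub hWGint)] at h0
    refine (hstrict hs 1 one_pos).ne (measure_congr ?_)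
    filter_upwards [h0] with ω hω
    have hω' : W ω = WG ω := sub_eq_zero.1 hω
    change (1 < 1 / 8 * WG ω) = (1 < 1 / 8 * W ω)
    rw [hω']
  · exact integral_congr_ae (ae_of_all _ fun ω =>
      quadForm_congr fun x hx => blockGren_of_strictAntiOn hp_anti hκ hs _ hx)
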